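/- Let $K\in\{0,1,-1\}$ and let $\phi(\rho)=\rho,\ \sin\rho,\ \sinh\rho$ and $a=\infty,\ \pi/2,\ \infty$, respectively. Let $N^{n+1}(K)$ be the space form given by the metric $g^N=d\rho^2+\phi(\rho)^2dz^2$ in spherical coordinates $(z,\rho)\in\mathbb S^n\times(0,a)$ of $\mathbb R^{n+1}$, where $dz^2$ is the standard metric of $\mathbb S^n$. Put $V=\phi(\rho)\,\partial_\rho$. Identify each tangent space of $N$ at a point $(z,\rho)$ isometrically with $\mathbb R^{n+1}$ by sending $\partial_\rho$ to $z$ and $\phi(\rho)^{-1}e$ to $e$ for $e\in T_z\mathbb S^n$; so $V$ becomes $\phi(\rho)z$, and unit tangent vectors become points of $\mathbb S^n$. Let $1\le k\le n$ and $0<R_1\le R_2<a$, and let $\psi(V,\nu)$ be a positive $C^2$ function on $\{V\in\mathbb R^{n+1}:\phi(R_1)\le|V|\le\phi(R_2)\}\times\mathbb S^n$ such that, for all fixed $z,\nu\in\mathbb S^n$, $$\frac{\partial}{\partial\rho}\big(\phi(\rho)^k\,\psi(\phi(\rho)z,\nu)\big)\le 0\qquad (R_1<\rho<R_2).$$ Then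 there are constants $C$ and $c>0$, depending only on $n,k,K,R_1,R_2$ and $\psi$, with the following property. Let $\rho\in C^3(\mathbb S^n)$ with $R_1\le\rho\le R_2$, let $M=\{(z,\rho(z)):z\in\mathbb S^n\}$ be its radial graph, with outward unit normal $\nu$ and principal curvatures $\kappa=(\kappa_1,\dots,\kappa_n)$ with respect to $g^N$ (positive for geodesic spheres centered at the origin), and suppose that $$\sigma_k(\kappa)=\psi(V,\nu)\quad\text{on } M,$$ where $\sigma_k$ is the $k$-th elementary symmetric function. Then $|\nabla'\rho|\le C$ on $\mathbb S^n$, where $\nabla'$ is the gradient for the standard metric of $\mathbb S^n$, and the support function satisfies $u=g^N(V,\nu)\ge c$ on $M$. -/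

import Mathlib

open scoped Manifold

noncomputable section

/-- The three simply connected model geometries of constant curvature `K = 0, +1, -1`. -/
inductive SpaceForm where
  | euclidean
  | spherical
  | hyperbolic

namespace SpaceForm

/-- The warping function `φ`: `φ(r) = r`, `sin r`, `sinh r` for `K = 0, 1, -1`. -/
def phi : SpaceForm → ℝ → ℝ
  | euclidean => fun r => r
  | spherical => Real.sin
  | hyperbolic => Real.sinh

/-- The upper end `a` of the radial interval: `∞`, `π / 2`, `∞` for `K = 0, 1, -1`. -/
def outerRadius : SpaceForm → EReal
  | euclidean => ⊤
  | spherical => ((Real.pi / 2 : ℝ) : EReal)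
  | hyperbolic => ⊤

end SpaceForm

/-- `ℝ^{n+1}`, which carries the spherical coordinates `(z, ρ)`, `x = ρ z`. -/
abbrev Amb (n : ℕ) := EuclideanSpace ℝ (Fin (n + 1))

/-- The unit sphere `𝕊ⁿ ⊂ ℝ^{n+1}`. -/
abbrev Sph (n : ℕ) := Metric.sphere (0 : Amb n) 1

/-- The direction `z = x / |x|` of a point `x ≠ 0`. -/
def dir {n : ℕ} (x : Amb n) : Amb n := ‖x‖⁻¹ • x

/-- The differential of the radial coordinate `ρ = |x|` at `x ≠ 0`. -/
def dRho {n : ℕ} (x v : Amb n) : ℝ := inner ℝ (dir x) v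

/-- The differential of the spherical coordinate `z = x / |x|` at `x ≠ 0`. -/
def dZ {n : ℕ} (x v : Amb n) : Amb n := ‖x‖⁻¹ • (v - dRho x v • dir x)

/-- The space form metric `g^N = dρ² + φ(ρ)² dz²` at the point `x ≠ 0` of `ℝ^{n+1}`. -/
def metricN (N : SpaceForm) {n : ℕ} (x v w : Amb n) : ℝ :=
  dRho x v * dRho x w + N.phi ‖x‖ ^ 2 * inner ℝ (dZ x v) (dZ x w)

/-- The Christoffel symbols of the first kind of the metric `g^N` in the Cartesian coordinates
of `ℝ^{n+1}`: for constant vector fields `v, w, y` this is `g^N(D_v w, y)`, with `D` the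
Levi-Civita connection of `g^N`. -/
def christoffelN (N : SpaceForm) {n : ℕ} (x v w y : Amb n) : ℝ :=
  (1 / 2) * (fderiv ℝ (fun p => metricN N p w y) x v + fderiv ℝ (fun p => metricN N p v y) x w
    - fderiv ℝ (fun p => metricN N p v w) x y)

/-- The linear isometry from `(T_x N, g^N)` to Euclidean `ℝ^{n+1}` that sends `∂_ρ` to
`z = x / |x|` and `φ(ρ)⁻¹ e` (with `e` tangent to `𝕊ⁿ` at `z`) to `e`. It is constant on fields that
are parallel along radial geodesics, and identifies unit tangent vectors of `N` with points
of `𝕊ⁿ`. -/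
def polarFrame (N : SpaceForm) {n : ℕ} (x v : Amb n) : Amb n :=
  dRho x v • dir x + N.phi ‖x‖ • dZ x v

/-- The extension of a function on `𝕊ⁿ` to `ℝ^{n+1}` which is constant along rays (and `0` at
the origin). At `z ∈ 𝕊ⁿ` its first two derivatives, evaluated on vectors tangent to `𝕊ⁿ`, are
the covariant derivatives for the standard metric of `𝕊ⁿ`, and its radial derivative vanishes. -/
def homExt {n : ℕ} (f : Sph n → ℝ) (x : Amb n) : ℝ :=
  open Classical in
  if h : x ≠ 0 then f ⟨dir x, by simp [dir, norm_smul, h]⟩ else 0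

/-- The gradient `∇'f` at `z` for the standard metric of `𝕊ⁿ`, a vector tangent to `𝕊ⁿ`. -/
def sphGrad {n : ℕ} (f : Sph n → ℝ) (z : Sph n) : Amb n := gradient (homExt f) (z : Amb n)

/-- The parametrization `z ↦ ρ(z) z` of the radial graph `M = {(z, ρ(z)) : z ∈ 𝕊ⁿ}`, extended
from `𝕊ⁿ` to be constant along rays. -/
def radialGraph {n : ℕ} (ρ : Sph n → ℝ) (x : Amb n) : Amb n := homExt ρ x • dir x

/-- The tangent vector of `M` which is the image of the tangent vector `X` of `𝕊ⁿ` at `z`. -/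
def pushTangent {n : ℕ} (ρ : Sph n → ℝ) (z : Sph n) (X : Amb n) : Amb n :=
  fderiv ℝ (radialGraph ρ) (z : Amb n) X

/-- `ν` is the outward unit normal of `M` at the point over `z`, for the metric `g^N`. -/
structure IsOuterUnitNormal (N : SpaceForm) {n : ℕ} (ρ : Sph n → ℝ) (z : Sph n) (ν : Amb n) :
    Prop where
  unit : metricN N (radialGraph ρ z) ν ν = 1
  normal : ∀ X : Amb n, inner ℝ (z : Amb n) X = 0 →
    metricN N (radialGraph ρ z) ν (pushTangent ρ z X) = 0
  outward : 0 < dRho (radialGraph ρ z) ν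

/-- The second fundamental form of `M` in `(N, g^N)` with respect to the normal `ν`, pulled back to
vectors `X, Y` tangent to `𝕊ⁿ` at `z`: `h(X, Y) = -g^N(D_X (dF Y), ν)`, where `F` is the
parametrization of `M` and `D` the Levi-Civita connection of `g^N`. The sign is such that
geodesic spheres have positive curvature with respect to the outward normal. -/
def secondFF (N : SpaceForm) {n : ℕ} (ρ : Sph n → ℝ) (z : Sph n) (ν X Y : Amb n) : ℝ :=
  -(metricN N (radialGraph ρ z) (fderiv ℝ (fderiv ℝ (radialGraph ρ)) (z : Amb n) X Y) ν
    + christoffelN N (radialGraph ρ z) (pushTangent ρ z X) (pushTangent ρ z Y) ν)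

/-- `κ₁, …, κₙ` are the principal curvatures, with multiplicity, of `M` at the point over `z`: in
some frame of the tangent space of `M`, orthonormal for the induced metric, the second
fundamental form is diagonal with entries `κ₁, …, κₙ`. -/
def ArePrincipalCurvatures (N : SpaceForm) {n : ℕ} (ρ : Sph n → ℝ) (z : Sph n) (ν : Amb n)
    (κ : Fin n → ℝ) : Prop :=
  ∃ e : Fin n → Amb n, (∀ i, inner ℝ (z : Amb n) (e i) = 0) ∧
    (∀ i j, metricN N (radialGraph ρ z) (pushTangent ρ z (e i)) (pushTangent ρ z (e j)) =
      if i = j then 1 else 0) ∧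
    (∀ i j, secondFF N ρ z ν (e i) (e j) = if i = j then κ i else 0)

/-- The elementary symmetric function `σ_k`. -/
def sigmaK {n : ℕ} (k : ℕ) (κ : Fin n → ℝ) : ℝ :=
  ∑ s ∈ Finset.powersetCard k (Finset.univ : Finset (Fin n)), ∏ i ∈ s, κ i

/-- The support function `u = g^N(V, ν)`, with `V = φ(ρ) ∂_ρ`; in Cartesian coordinates `∂_ρ` at
the point `ρ z` is the vector `z`. -/
def supportFn (N : SpaceForm) {n : ℕ} (ρ : Sph n → ℝ) (z : Sph n) (ν : Amb n) : ℝ :=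
  metricN N (radialGraph ρ z) (N.phi (ρ z) • (z : Amb n)) ν

/-- The pairs `(V, ν)` with `φ(R₁) ≤ |V| ≤ φ(R₂)` and `|ν| = 1`. -/
def dataShell (N : SpaceForm) (n : ℕ) (R₁ R₂ : ℝ) : Set (Amb n × Amb n) :=
  {p | N.phi R₁ ≤ ‖p.1‖ ∧ ‖p.1‖ ≤ N.phi R₂ ∧ ‖p.2‖ = 1}

end

open scoped Manifold

/-!
# The gradient estimate for radial graphs of prescribed curvature in space forms

Put `v = φ'(ρ) / φ(ρ)` on the sphere and let `s(x) = |x| v(x / |x|)` be its extension to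
`ℝ^{n+1}` that is homogeneous of degree one. (In the geodesic projection of the space form to
`ℝ^{n+1}`, `s` is the Minkowski gauge of the domain bounded by the graph.) Everything in the
statement is expressed through `s`. With `τ` the spherical gradient of `s` and
`E = |∇s|² + K = |τ|² + φ⁻²`, the support function is `E^{-1/2}`, the gradient of `ρ` is `-φ² τ`,
the transported normal is `(z + φ τ) / (φ √E)`, and the principal curvatures, multiplied
by `φ √E`, are the eigenvalues on the tangent space of the sphere of the operator
`(1 - E⁻¹ τ ⊗ τ) ∘ D²s` (`exists_basis_shapeOp`). Both claims therefore amount to an upper bound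
for `E`, and the curvature equation becomes `σ_k((1 - E⁻¹ τ ⊗ τ) D²s) = E^{k/2} φ^k ψ`, where the
product `φ^k ψ` is the one whose radial monotonicity is assumed.

No admissibility of the curvatures is assumed, but it is automatic. At the point farthest from the
origin all curvatures are positive, and the Gårding cone is a connected component of
`{σ_k > 0}` (`gardingCone_of_preconnected`, from Newton's and Maclaurin's inequalities), so the
curvatures lie in the cone everywhere (`elemPoly_shapeOp_pos`).

The bound for `E` comes from the maximum principle for the test function `log √E + α v`. At its
maximum `τ` is an eigenvector of `D²s` with the negative eigenvalue `-α E`. The second order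
condition, contracted with the positive derivatives of `σ_k`, and the equation differentiated in
the direction `τ` combine to `IsGauge.exists_deriv_elemPoly_le`. In that inequality the square of
the eigenvalue produces a term of order `α² S₁ E`, where `S₁`, the derivative of `σ_k` with respect
to the negative eigenvalue, dominates `σ_{k-1}` and so, by Maclaurin's inequality, a power of `E`.
The derivative of the right-hand side is only linear in `α`, since the radial derivative of `φ^k ψ`
has a favourable sign (`exists_deriv_rhs_ge`). For `α` large this bounds `E` at the maximum
(`energy_le_of_isLocalMax`), hence everywhere.
-/


/-! ### Elementary symmetric functions of real numbers -/

open Polynomial in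
/-- The generating polynomial `∏ i ∈ s, (1 + μ i X)` of the elementary symmetric functions
of the numbers `μ i`, `i ∈ s`. Its coefficients are these functions. -/
noncomputable def genPoly {ι : Type*} (s : Finset ι) (μ : ι → ℝ) : Polynomial ℝ :=
  ∏ i ∈ s, (1 + C (μ i) * X)

section SymmetricFunctions

open Polynomial

theorem Polynomial.Splits.derivative_real {p : ℝ[X]} (hp : p.Splits) :
    (derivative p).Splits := by
  by_cases h0 : derivative p = 0
  · rw [h0]; exact Splits.zero
  rw [splits_iff_card_roots] at hp ⊢
  have h1 := card_roots_le_derivative p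
  have h2 := card_roots' (derivative p)
  have h3 : (derivative p).natDegree < p.natDegree := by
    refine natDegree_derivative_lt fun h => h0 ?_
    exact derivative_of_natDegree_zero h
  omega

theorem Polynomial.Splits.iterate_derivative_real {p : ℝ[X]} (hp : p.Splits) (j : ℕ) :
    (derivative^[j] p).Splits := by
  induction j with
  | zero => simpa using hp
  | succ j ih => rw [Function.iterate_succ_apply']; exact ih.derivative_real

/-- Laguerre's inequality: `p'² - p p''` is nonnegative for a real-rooted `p`, because
`-(p'/p)'` is a sum of squares. -/
theorem Polynomial.Splits.laguerre {p : ℝ[X]} (hp : p.Splits) (x : ℝ) :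
    p.eval x * (derivative (derivative p)).eval x ≤ ((derivative p).eval x) ^ 2 := by
  have key : ∀ (m : Multiset ℝ) (q : ℝ[X]),
      q.eval x * (derivative (derivative q)).eval x ≤ ((derivative q).eval x) ^ 2 →
      ((m.map (X - C ·)).prod * q).eval x *
        (derivative (derivative ((m.map (X - C ·)).prod * q))).eval x ≤
        ((derivative ((m.map (X - C ·)).prod * q)).eval x) ^ 2 := by
    intro m q hq
    induction m using Multiset.induction_on with
    | empty => simpa using hq
    | cons r m ih =>
      rw [Multiset.map_cons, Multiset.prod_cons, mul_assoc]
      set P := (m.map (X - C ·)).prod * q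
      simp only [derivative_mul, derivative_sub, derivative_X, derivative_C, derivative_add,
        eval_mul, eval_add, eval_sub, eval_X, eval_C, sub_zero, one_mul]
      nlinarith [sq_nonneg (P.eval x), mul_le_mul_of_nonneg_left ih (sq_nonneg (x - r))]
  have h := key p.roots (C p.leadingCoeff) (by simp)
  rwa [mul_comm _ (C p.leadingCoeff), ← hp.eq_prod_roots] at h

/-- Newton's inequality for the coefficients of a real-rooted polynomial, without the
binomial constant. -/
theorem Polynomial.Splits.newton {p : ℝ[X]} (hp : p.Splits) (j : ℕ) :
    p.coeff j * p.coeff (j + 2) ≤ p.coeff (j + 1) ^ 2 := by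
  have h := (hp.iterate_derivative_real j).laguerre 0
  rw [← coeff_zero_eq_eval_zero, ← coeff_zero_eq_eval_zero, ← coeff_zero_eq_eval_zero,
    coeff_derivative, coeff_derivative, coeff_derivative, coeff_iterate_derivative,
    coeff_iterate_derivative, coeff_iterate_derivative] at h
  have e0 : (0 + j).descFactorial j = j.factorial := by simp [Nat.descFactorial_self]
  have e1 : (0 + 1 + j).descFactorial j = (j + 1).factorial := by
    rw [Nat.descFactorial_eq_factorial_mul_choose, zero_add, add_comm 1 j,
      Nat.choose_succ_self_right, Nat.factorial_succ, mul_comm]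
  have e2 : (0 + 1 + 1 + j).descFactorial j * 2 = (j + 2).factorial := by
    have := Nat.factorial_mul_descFactorial (show j ≤ j + 2 by omega)
    simp only [Nat.add_sub_cancel_left, Nat.factorial_two] at this
    rw [show 0 + 1 + 1 + j = j + 2 by omega]; omega
  have e2' : ((0 + 1 + 1 + j).descFactorial j : ℝ) * 2 = (j + 2).factorial := by
    exact_mod_cast e2
  simp only [nsmul_eq_mul, e0, e1] at h
  have f1 : ((j + 2).factorial : ℝ) = (j + 2) * ((j + 1) * j.factorial) := by
    rw [Nat.factorial_succ, Nat.factorial_succ]; push_cast; ring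
  have f2 : ((j + 1).factorial : ℝ) = (j + 1) * j.factorial := by
    rw [Nat.factorial_succ]; push_cast; ring
  rw [f1] at e2'
  rw [f2] at h
  have hf : (0 : ℝ) < j.factorial := by exact_mod_cast j.factorial_pos
  rw [show 0 + 1 + 1 + j = j + 2 by omega, show 0 + 1 + j = j + 1 by omega, zero_add] at h
  rw [show 0 + 1 + 1 + j = j + 2 by omega] at e2'
  norm_num at h
  have h' : (j + 2 : ℝ) * (p.coeff j * p.coeff (j + 2)) ≤ (j + 1) * p.coeff (j + 1) ^ 2 := by
    have h'' : (((j : ℝ) + 1) * (j.factorial : ℝ) ^ 2) *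
        ((j + 2 : ℝ) * (p.coeff j * p.coeff (j + 2))) ≤
        (((j : ℝ) + 1) * (j.factorial : ℝ) ^ 2) * ((j + 1) * p.coeff (j + 1) ^ 2) := by
      calc _ = (j.factorial : ℝ) * p.coeff j *
            (((j + 2).descFactorial j : ℝ) * p.coeff (j + 2) * 2) := by
              linear_combination (-(j.factorial : ℝ) * p.coeff j * p.coeff (j + 2)) * e2'
        _ ≤ (((j : ℝ) + 1) * j.factorial * p.coeff (j + 1)) ^ 2 := h
        _ = _ := by ring
    exact le_of_mul_le_mul_left h'' (by positivity)
  rcases le_or_gt (p.coeff j * p.coeff (j + 2)) 0 with hn | hn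
  · exact hn.trans (sq_nonneg _)
  · have : (0 : ℝ) ≤ j := Nat.cast_nonneg j
    nlinarith [sq_nonneg (p.coeff (j + 1))]

variable {ι : Type*} (s : Finset ι) (μ : ι → ℝ)

theorem genPoly_splits : (genPoly s μ).Splits := by
  refine Splits.prod fun i _ => ?_
  exact Splits.of_natDegree_le_one (by compute_degree)

theorem coeff_genPoly (k : ℕ) :
    (genPoly s μ).coeff k = ∑ t ∈ s.powersetCard k, ∏ i ∈ t, μ i := by
  classical
  rw [genPoly, Finset.prod_one_add]
  rw [finsetSum_coeff, ← Finset.sum_subset (s₁ := s.powersetCard k)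
    (fun t ht => Finset.mem_powerset.2 (Finset.mem_powersetCard.1 ht).1)]
  · refine Finset.sum_congr rfl fun t ht => ?_
    rw [Finset.prod_mul_distrib, Finset.prod_const, ← map_prod, coeff_C_mul_X_pow,
      if_pos (Finset.mem_powersetCard.1 ht).2.symm]
  · intro t ht ht'
    rw [Finset.prod_mul_distrib, Finset.prod_const, ← map_prod, coeff_C_mul_X_pow, if_neg]
    rintro rfl
    exact ht' (Finset.mem_powersetCard.2 ⟨Finset.mem_powerset.1 ht, rfl⟩)

theorem eval_genPoly (t : ℝ) : (genPoly s μ).eval t = ∏ i ∈ s, (1 + t * μ i) := by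
  rw [genPoly, eval_prod]
  exact Finset.prod_congr rfl fun i _ => by simp [mul_comm t]

theorem natDegree_genPoly_le : (genPoly s μ).natDegree ≤ s.card := by
  refine (natDegree_prod_le _ _).trans ?_
  rw [Finset.card_eq_sum_ones]
  exact Finset.sum_le_sum fun i _ => by compute_degree

theorem genPoly_coeff_zero : (genPoly s μ).coeff 0 = 1 := by simp [coeff_genPoly]

variable {s} in
theorem genPoly_eq_erase [DecidableEq ι] {i : ι} (hi : i ∈ s) :
    genPoly s μ = (1 + C (μ i) * X) * genPoly (s.erase i) μ :=
  (Finset.mul_prod_erase s _ hi).symm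

variable {s} in
/-- `σ_{k+1}(μ) = σ_{k+1}(μ | i) + μ_i σ_k(μ | i)`. -/
theorem genPoly_coeff_succ_erase [DecidableEq ι] {i : ι} (hi : i ∈ s) (k : ℕ) :
    (genPoly s μ).coeff (k + 1) =
      (genPoly (s.erase i) μ).coeff (k + 1) + μ i * (genPoly (s.erase i) μ).coeff k := by
  rw [genPoly_eq_erase μ hi, add_mul, one_mul, coeff_add, mul_assoc, coeff_C_mul, coeff_X_mul]

/-- Removing an entry maps the Gårding cone `Γ_{k+1}` into `Γ_k`. -/
theorem genPoly_erase_coeff_pos [DecidableEq ι] {i : ι} (hi : i ∈ s) {k : ℕ}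
    (h : ∀ j ≤ k + 1, 0 < (genPoly s μ).coeff j) :
    ∀ j ≤ k, 0 < (genPoly (s.erase i) μ).coeff j := by
  intro j
  induction j with
  | zero => intro _; rw [genPoly_coeff_zero]; exact one_pos
  | succ j ih =>
    intro hj
    have a0 := ih (by omega)
    have h1 := h (j + 1) (by omega)
    have h2 := h (j + 2) (by omega)
    rw [genPoly_coeff_succ_erase μ hi] at h1 h2
    have hN := (genPoly_splits (s.erase i) μ).newton j
    -- Otherwise `μ i > 0` is so large that `σ_{j+2}(μ) > 0` contradicts Newton's inequality.
    by_contra hneg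
    push Not at hneg
    set a := (genPoly (s.erase i) μ).coeff j
    set b := (genPoly (s.erase i) μ).coeff (j + 1)
    set c := (genPoly (s.erase i) μ).coeff (j + 2)
    have h3 : 0 < a * (c + μ i * b) := mul_pos a0 h2
    nlinarith [mul_nonneg_of_nonpos_of_nonpos hneg (show -(b + μ i * a) ≤ 0 by linarith)]

/-- A form of Maclaurin's inequality: `σ_{j+1}^j ≤ σ_j^{j+1}` on the Gårding cone. -/
theorem genPoly_maclaurin {k : ℕ} (h : ∀ j ≤ k, 0 < (genPoly s μ).coeff j) :
    ∀ j, j + 1 ≤ k → (genPoly s μ).coeff (j + 1) ^ j ≤ (genPoly s μ).coeff j ^ (j + 1) := by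
  intro j
  induction j with
  | zero => intro _; simp [genPoly_coeff_zero]
  | succ j ih =>
    intro hj
    have h0 := h j (by omega)
    have h1 := h (j + 1) (by omega)
    have h2 := h (j + 2) (by omega)
    have hN := (genPoly_splits s μ).newton j
    have ih := ih (by omega)
    set a := (genPoly s μ).coeff j
    set b := (genPoly s μ).coeff (j + 1)
    set c := (genPoly s μ).coeff (j + 2)
    have key : a ^ (j + 1) * c ^ (j + 1) ≤ a ^ (j + 1) * b ^ (j + 2) := by
      calc a ^ (j + 1) * c ^ (j + 1) = (a * c) ^ (j + 1) := (mul_pow _ _ _).symm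
        _ ≤ (b ^ 2) ^ (j + 1) := pow_le_pow_left₀ (by positivity) hN _
        _ = b ^ j * b ^ (j + 2) := by rw [← pow_mul, ← pow_add]; congr 1; ring
        _ ≤ a ^ (j + 1) * b ^ (j + 2) := by gcongr
    exact le_of_mul_le_mul_left key (by positivity)

/-- If an entry is nonpositive, then deleting it does not decrease `σ_k` on the cone
`Γ_{k+1}`. -/
theorem genPoly_coeff_le_erase [DecidableEq ι] {i : ι} (hi : i ∈ s) (hμ : μ i ≤ 0) {k : ℕ}
    (h : ∀ j ≤ k + 1, 0 < (genPoly s μ).coeff j) :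
    (genPoly s μ).coeff k ≤ (genPoly (s.erase i) μ).coeff k := by
  cases k with
  | zero => rw [genPoly_coeff_zero, genPoly_coeff_zero]
  | succ k =>
    rw [genPoly_coeff_succ_erase μ hi]
    have := genPoly_erase_coeff_pos s μ hi h k (by omega)
    nlinarith

/-- Euler's identity `∑ μ_i σ_k(μ | i) = (k + 1) σ_{k+1}(μ)`. -/
theorem sum_mul_genPoly_erase [DecidableEq ι] (k : ℕ) :
    ∑ i ∈ s, μ i * (genPoly (s.erase i) μ).coeff k = (k + 1) * (genPoly s μ).coeff (k + 1) := by
  have h : derivative (genPoly s μ) = ∑ i ∈ s, C (μ i) * genPoly (s.erase i) μ := by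
    rw [genPoly, derivative_prod_finset]
    refine Finset.sum_congr rfl fun i _ => ?_
    rw [genPoly, derivative_add, derivative_one, zero_add, derivative_C_mul, derivative_X, mul_one,
      mul_comm]
  have := congrArg (fun q => q.coeff k) h
  simp only [coeff_derivative, finsetSum_coeff, coeff_C_mul] at this
  rw [← this]; ring

/-- `∑ σ_k(μ | i) = (N - k) σ_k(μ)`, as an inequality. -/
theorem sum_genPoly_erase_le [DecidableEq ι] {k : ℕ} (h : 0 < (genPoly s μ).coeff k) :
    ∑ i ∈ s, (genPoly (s.erase i) μ).coeff k ≤ s.card * (genPoly s μ).coeff k := by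
  cases k with
  | zero => simp [genPoly_coeff_zero]
  | succ k =>
    have h1 : ∀ i ∈ s, (genPoly (s.erase i) μ).coeff (k + 1) =
        (genPoly s μ).coeff (k + 1) - μ i * (genPoly (s.erase i) μ).coeff k := fun i hi => by
      rw [genPoly_coeff_succ_erase μ hi]; ring
    rw [Finset.sum_congr rfl h1, Finset.sum_sub_distrib, sum_mul_genPoly_erase]
    simp only [Finset.sum_const, nsmul_eq_mul]
    nlinarith [mul_pos (show (0 : ℝ) < k + 1 by positivity) h]

end SymmetricFunctions

theorem sigmaK_eq_coeff {n : ℕ} (k : ℕ) (κ : Fin n → ℝ) :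
    sigmaK k κ = (genPoly Finset.univ κ).coeff k := by
  rw [coeff_genPoly]; rfl

/-! ### Elementary symmetric functions of linear maps -/

open Polynomial in
/-- The coefficients of a polynomial of degree at most `N` are fixed linear combinations of
its values at `0, …, N`. -/
theorem exists_coeff_eq_sum_eval (N m : ℕ) : ∃ c : ℕ → ℝ, ∀ p : ℝ[X], p.natDegree ≤ N →
    p.coeff m = ∑ i ∈ Finset.range (N + 1), c i * p.eval (i : ℝ) := by
  refine ⟨fun i => (Lagrange.basis (Finset.range (N + 1)) (fun i : ℕ => (i : ℝ)) i).coeff m,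
    fun p hp => ?_⟩
  have hinj : Set.InjOn (fun i : ℕ => (i : ℝ)) (Finset.range (N + 1)) :=
    fun i _ j _ h => Nat.cast_injective h
  have h := Lagrange.eq_interpolate (f := p) hinj (by
    rw [Finset.card_range]
    exact lt_of_le_of_lt degree_le_natDegree (by exact_mod_cast Nat.lt_succ_of_le hp))
  conv_lhs => rw [h]
  rw [Lagrange.interpolate_apply, finsetSum_coeff]
  exact Finset.sum_congr rfl fun i _ => by rw [coeff_C_mul, mul_comm]

/-- The derivative of the determinant at a diagonal matrix: only the diagonal entries of the
variation contribute. -/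
theorem hasDerivAt_det_of_diagonal {ι : Type*} [Fintype ι] [DecidableEq ι]
    {M : ℝ → Matrix ι ι ℝ} {M' : Matrix ι ι ℝ} {x : ℝ}
    (hM : ∀ i j, HasDerivAt (fun y => M y i j) (M' i j) x)
    (hdiag : ∀ i j, i ≠ j → M x i j = 0) :
    HasDerivAt (fun y => (M y).det) (∑ i, M' i i * ∏ j ∈ Finset.univ.erase i, M x j j) x := by
  simp only [Matrix.det_apply']
  have h : ∀ σ : Equiv.Perm ι, HasDerivAt
      (fun y => ((Equiv.Perm.sign σ : ℤ) : ℝ) * ∏ i, M y (σ i) i)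
      (if σ = 1 then ∑ i, M' i i * ∏ j ∈ Finset.univ.erase i, M x j j else 0) x := by
    intro σ
    have h1 := (HasDerivAt.fun_finsetProd (u := Finset.univ)
      (fun i _ => hM (σ i) i)).const_mul ((Equiv.Perm.sign σ : ℤ) : ℝ)
    refine h1.congr_deriv ?_
    symm
    split_ifs with hσ
    · subst hσ
      simp [mul_comm]
    · obtain ⟨a, ha⟩ : ∃ a, σ a ≠ a := by
        by_contra hcon
        push Not at hcon
        exact hσ (Equiv.ext hcon)
      have ha' : σ (σ a) ≠ σ a := fun h => ha (σ.injective h)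
      rw [eq_comm, Finset.sum_eq_zero, mul_zero]
      intro i _
      -- A permutation other than `1` moves two indices, so a zero factor survives.
      have : ∃ j ∈ Finset.univ.erase i, M x (σ j) j = 0 := by
        by_cases hi : a = i
        · exact ⟨σ a, by simp [← hi, ha], hdiag _ _ ha'⟩
        · exact ⟨a, by simp [hi], hdiag _ _ ha⟩
      obtain ⟨j, hj, hj0⟩ := this
      have hz := Finset.prod_eq_zero (f := fun j => M x (σ j) j) hj hj0
      exact (congrArg (· * M' (σ i) i) hz).trans (zero_mul _)
  have hs := HasDerivAt.fun_sum (u := Finset.univ) fun σ (_ : σ ∈ Finset.univ) => h σ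
  refine hs.congr_deriv ?_
  rw [Finset.sum_ite_eq' Finset.univ (1 : Equiv.Perm ι), if_pos (Finset.mem_univ _)]

section LinearMaps

open Polynomial

variable {V : Type*} [NormedAddCommGroup V] [InnerProductSpace ℝ V] [FiniteDimensional ℝ V]

/-- The polynomial `det (1 + X T)`, whose coefficients are the elementary symmetric functions of
the eigenvalues of `T`. -/
noncomputable def elemPoly (T : V →L[ℝ] V) : ℝ[X] :=
  Matrix.det ((X : ℝ[X]) •
    (LinearMap.toMatrix (Module.finBasis ℝ V) (Module.finBasis ℝ V) (T : V →ₗ[ℝ] V)).map C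
      + (1 : Matrix _ _ ℝ).map C)

theorem eval_elemPoly (T : V →L[ℝ] V) (t : ℝ) :
    (elemPoly T).eval t = (1 + t • T : V →L[ℝ] V).det := by
  have h : (elemPoly T).eval t = evalRingHom t (elemPoly T) := rfl
  rw [h, elemPoly, RingHom.map_det, ContinuousLinearMap.det,
    ← LinearMap.det_toMatrix (Module.finBasis ℝ V)]
  congr 1
  have h2 : ((1 + t • T : V →L[ℝ] V) : V →ₗ[ℝ] V) = 1 + t • (T : V →ₗ[ℝ] V) := rfl
  rw [h2, (LinearMap.toMatrix _ _).map_add, (LinearMap.toMatrix _ _).map_smul,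
    LinearMap.toMatrix_one]
  ext i j
  simp [Matrix.one_apply, apply_ite, add_comm, mul_comm t]

theorem natDegree_elemPoly_le (T : V →L[ℝ] V) :
    (elemPoly T).natDegree ≤ Module.finrank ℝ V := by
  refine (natDegree_det_X_add_C_le _ _).trans ?_
  simp

theorem continuous_elemPoly_coeff (m : ℕ) :
    Continuous fun T : V →L[ℝ] V => (elemPoly T).coeff m := by
  obtain ⟨c, hc⟩ := exists_coeff_eq_sum_eval (Module.finrank ℝ V) m
  simp only [hc _ (natDegree_elemPoly_le _), eval_elemPoly]
  refine continuous_finsetSum _ fun i _ => continuous_const.mul ?_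
  exact ContinuousLinearMap.continuous_det.comp (by fun_prop)

/-- In a basis of eigenvectors, `det (1 + X T) = ∏ (1 + μ_i X)`. -/
theorem elemPoly_eq_genPoly {ι : Type*} [Fintype ι] [DecidableEq ι] (b : Module.Basis ι ℝ V)
    {T : V →L[ℝ] V} {μ : ι → ℝ} (hT : ∀ i, T (b i) = μ i • b i) :
    elemPoly T = genPoly Finset.univ μ := by
  refine Polynomial.funext fun t => ?_
  rw [eval_elemPoly, eval_genPoly, ContinuousLinearMap.det, ← LinearMap.det_toMatrix b,
    show LinearMap.toMatrix b b ((1 + t • T : V →L[ℝ] V) : V →ₗ[ℝ] V) =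
      Matrix.diagonal fun i => 1 + t * μ i from ?_, Matrix.det_diagonal]
  ext i j
  rw [LinearMap.toMatrix_apply, Matrix.diagonal_apply]
  simp only [ContinuousLinearMap.coe_coe, add_apply,
    one_apply_eq_self, smul_apply, hT, map_add, map_smul,
    Finsupp.add_apply, Finsupp.smul_apply, Module.Basis.repr_self, Finsupp.single_apply]
  by_cases h : i = j
  · simp [h]
  · simp [h, Ne.symm h]

/-- The derivative of `σ_{m+1}` at a map which is diagonal in an orthonormal basis. -/
theorem hasDerivAt_elemPoly_coeff {ι : Type*} [Fintype ι] [DecidableEq ι]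
    (b : OrthonormalBasis ι ℝ V) {T : ℝ → V →L[ℝ] V} {x : ℝ} {μ T' : ι → ℝ}
    (hT : ∀ i, T x (b i) = μ i • b i) (hd : DifferentiableAt ℝ T x)
    (hT' : ∀ i, HasDerivAt (fun y => inner ℝ (b i) (T y (b i))) (T' i) x) (m : ℕ) :
    HasDerivAt (fun y => (elemPoly (T y)).coeff (m + 1))
      (∑ i, T' i * (genPoly (Finset.univ.erase i) μ).coeff m) x := by
  set Q : ℝ[X] := ∑ i, C (T' i) * X * genPoly (Finset.univ.erase i) μ with hQ
  have hcard : Fintype.card ι = Module.finrank ℝ V := by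
    rw [Module.finrank_eq_card_basis b.toBasis]
  have hQdeg : Q.natDegree ≤ Module.finrank ℝ V := by
    refine natDegree_sum_le_of_forall_le _ _ fun i _ => ?_
    refine natDegree_mul_le.trans ?_
    have h1 := natDegree_genPoly_le (Finset.univ.erase i) μ
    rw [Finset.card_erase_of_mem (Finset.mem_univ i), Finset.card_univ, hcard] at h1
    have h2 : (C (T' i) * X).natDegree ≤ 1 := by compute_degree
    have h3 : 0 < Module.finrank ℝ V := by
      rw [← hcard]; exact Fintype.card_pos_iff.2 ⟨i⟩
    omega
  have hval : ∀ t : ℝ, HasDerivAt (fun y => (elemPoly (T y)).eval t) (Q.eval t) x := by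
    intro t
    have hM : ∀ y, (elemPoly (T y)).eval t = Matrix.det (Matrix.of fun i j =>
        (if i = j then 1 else 0) + t * inner ℝ (b i) (T y (b j))) := by
      intro y
      rw [eval_elemPoly, ContinuousLinearMap.det, ← LinearMap.det_toMatrix b.toBasis]
      congr 1
      ext i j
      rw [LinearMap.toMatrix_apply, OrthonormalBasis.coe_toBasis_repr_apply,
        OrthonormalBasis.repr_apply_apply]
      simp [inner_add_right, inner_smul_right, OrthonormalBasis.inner_eq_ite]
    simp only [hM]
    have hentry : ∀ i j, HasDerivAt (fun y => (inner ℝ (b i) (T y (b j)) : ℝ))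
        (inner ℝ (b i) (deriv T x (b j))) x := fun i j => by
      have h1 := hd.hasDerivAt.clm_apply (hasDerivAt_const x (b j))
      have := (hasDerivAt_const x (b i)).inner ℝ h1
      simpa using this
    have h1 := hasDerivAt_det_of_diagonal
      (M := fun y => Matrix.of fun i j =>
        (if i = j then (1 : ℝ) else 0) + t * inner ℝ (b i) (T y (b j)))
      (M' := Matrix.of fun i j => t * inner ℝ (b i) (deriv T x (b j))) (x := x)
      (fun i j => by
        simpa using ((hentry i j).const_mul t).const_add (if i = j then (1 : ℝ) else 0))
      (fun i j hij => by simp [hT, inner_smul_right, OrthonormalBasis.inner_eq_ite, hij])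
    refine h1.congr_deriv ?_
    symm
    rw [hQ, eval_finsetSum]
    refine Finset.sum_congr rfl fun i _ => ?_
    rw [eval_mul, eval_genPoly, (hT' i).unique (hentry i i)]
    simp only [eval_mul, eval_C, eval_X, Matrix.of_apply, hT, inner_smul_right,
      OrthonormalBasis.inner_eq_ite, if_true, mul_one]
    ring
  obtain ⟨c, hc⟩ := exists_coeff_eq_sum_eval (Module.finrank ℝ V) (m + 1)
  simp only [hc _ (natDegree_elemPoly_le _)]
  have hQm : ∑ i, T' i * (genPoly (Finset.univ.erase i) μ).coeff m = Q.coeff (m + 1) := by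
    rw [hQ, finsetSum_coeff]
    exact Finset.sum_congr rfl fun i _ => by rw [mul_assoc, coeff_C_mul, coeff_X_mul]
  rw [hQm, hc _ hQdeg]
  exact HasDerivAt.fun_sum fun i _ => (hval i).const_mul _

end LinearMaps

/-! ### The warping function -/

namespace SpaceForm

/-- The sectional curvature `K` of the model geometry. -/
def curv : SpaceForm → ℝ
  | euclidean => 0
  | spherical => 1
  | hyperbolic => -1

/-- The derivative `φ'` of the warping function: `1`, `cos`, `cosh`. -/
noncomputable def dphi : SpaceForm → ℝ → ℝ
  | euclidean => fun _ => 1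
  | spherical => Real.cos
  | hyperbolic => Real.cosh

/-- `φ' / φ`, the principal curvature of the geodesic sphere of radius `r`. -/
noncomputable def cot (N : SpaceForm) (r : ℝ) : ℝ := N.dphi r / N.phi r

variable (N : SpaceForm)

theorem hasDerivAt_phi (r : ℝ) : HasDerivAt N.phi (N.dphi r) r := by
  cases N
  · exact hasDerivAt_id r
  · exact Real.hasDerivAt_sin r
  · exact Real.hasDerivAt_sinh r

theorem hasDerivAt_dphi (r : ℝ) : HasDerivAt N.dphi (-N.curv * N.phi r) r := by
  cases N
  · simpa [dphi, curv] using hasDerivAt_const r (1 : ℝ)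
  · simpa [dphi, curv, phi] using Real.hasDerivAt_cos r
  · simpa [dphi, curv, phi] using Real.hasDerivAt_cosh r

theorem dphi_sq_add (r : ℝ) : N.dphi r ^ 2 + N.curv * N.phi r ^ 2 = 1 := by
  cases N
  · simp [dphi, curv]
  · simp [dphi, curv, phi]
  · have := Real.cosh_sq r
    simp only [dphi, curv, phi]; linarith

theorem contDiff_phi {m : WithTop ℕ∞} : ContDiff ℝ m N.phi := by
  cases N
  · exact contDiff_id
  · exact Real.contDiff_sin
  · exact Real.contDiff_sinh

theorem contDiff_dphi {m : WithTop ℕ∞} : ContDiff ℝ m N.dphi := by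
  cases N
  · exact contDiff_const
  · exact Real.contDiff_cos
  · exact Real.contDiff_cosh

theorem phi_pos {r : ℝ} (h0 : 0 < r) (hr : (r : EReal) < N.outerRadius) : 0 < N.phi r := by
  cases N
  · exact h0
  · have : r < Real.pi / 2 := EReal.coe_lt_coe_iff.1 hr
    exact Real.sin_pos_of_pos_of_lt_pi h0 (by linarith [Real.pi_pos])
  · exact Real.sinh_pos_iff.2 h0

theorem dphi_pos {r : ℝ} (h0 : 0 < r) (hr : (r : EReal) < N.outerRadius) : 0 < N.dphi r := by
  cases N
  · exact one_pos
  · have : r < Real.pi / 2 := EReal.coe_lt_coe_iff.1 hr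
    exact Real.cos_pos_of_mem_Ioo ⟨by linarith [Real.pi_pos], this⟩
  · exact Real.cosh_pos r

theorem contDiffAt_cot {r : ℝ} (h : N.phi r ≠ 0) {m : WithTop ℕ∞} : ContDiffAt ℝ m N.cot r :=
  N.contDiff_dphi.contDiffAt.div N.contDiff_phi.contDiffAt h

theorem hasDerivAt_cot {r : ℝ} (h : N.phi r ≠ 0) :
    HasDerivAt N.cot (-(N.phi r ^ 2)⁻¹) r := by
  refine ((N.hasDerivAt_dphi r).div (N.hasDerivAt_phi r) h).congr_deriv ?_
  have := N.dphi_sq_add r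
  field_simp
  linarith

theorem cot_sq_add {r : ℝ} (h : N.phi r ≠ 0) : N.cot r ^ 2 + N.curv = (N.phi r ^ 2)⁻¹ := by
  rw [cot]
  have := N.dphi_sq_add r
  field_simp
  linarith

end SpaceForm

/-! ### Spherical coordinates and functions on the sphere -/

section SphericalCoordinates

variable {n : ℕ}

theorem norm_dir {x : Amb n} (hx : x ≠ 0) : ‖dir x‖ = 1 := by simp [dir, norm_smul, hx]

theorem dir_of_norm_one {z : Amb n} (hz : ‖z‖ = 1) : dir z = z := by simp [dir, hz]

theorem dir_smul {t : ℝ} (ht : 0 < t) (x : Amb n) : dir (t • x) = dir x := by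
  rw [dir, dir, norm_smul, Real.norm_of_nonneg ht.le, smul_smul]
  congr 1
  field_simp

theorem hasFDerivAt_norm_amb {x : Amb n} (hx : x ≠ 0) :
    HasFDerivAt (fun y : Amb n => ‖y‖) (innerSL ℝ (dir x)) x := by
  have h := (hasStrictFDerivAt_norm_sq x).hasFDerivAt.sqrt (by positivity)
  simp only [Real.sqrt_sq (norm_nonneg _)] at h
  refine h.congr_fderiv ?_
  ext v
  simp only [dir, map_smul, smul_apply, innerSL_apply_apply, smul_eq_mul, nsmul_eq_mul]
  simp
  ring

theorem fderiv_dir {x : Amb n} (hx : x ≠ 0) (v : Amb n) :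
    fderiv ℝ (dir : Amb n → Amb n) x v = dZ x v := by
  have h1 : HasFDerivAt (fun y : Amb n => ‖y‖⁻¹) _ x :=
    (hasDerivAt_inv (norm_ne_zero_iff.2 hx)).comp_hasFDerivAt x (hasFDerivAt_norm_amb hx)
  have h2 := h1.smul (hasFDerivAt_id x)
  rw [show (dir : Amb n → Amb n) = (fun y : Amb n => ‖y‖⁻¹) • id from
    funext fun _ => rfl, h2.fderiv]
  have hx' : ‖x‖ ≠ 0 := norm_ne_zero_iff.2 hx
  simp only [dZ, dRho, dir, add_apply, smul_apply, ContinuousLinearMap.smulRight_apply,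
    ContinuousLinearMap.id_apply, id, innerSL_apply_apply, smul_eq_mul, smul_sub, smul_smul]
  rw [sub_eq_add_neg, ← neg_smul]
  congr 2
  field_simp

theorem contDiffAt_dir {x : Amb n} (hx : x ≠ 0) {m : WithTop ℕ∞} :
    ContDiffAt ℝ m (dir : Amb n → Amb n) x :=
  ((contDiffAt_norm ℝ hx).inv (norm_ne_zero_iff.2 hx)).smul contDiffAt_id

theorem homExt_eq {f : Sph n → ℝ} {x : Amb n} (hx : x ≠ 0) :
    homExt f x = f ⟨dir x, by simp [norm_dir hx]⟩ := by
  rw [homExt, dif_pos hx]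

theorem homExt_sphere (f : Sph n → ℝ) (z : Sph n) : homExt f (z : Amb n) = f z := by
  have hz : ‖(z : Amb n)‖ = 1 := by simp
  rw [homExt_eq (by intro h; simp [h] at hz)]
  congr 1
  exact Subtype.ext (dir_of_norm_one hz)

theorem homExt_smul (f : Sph n → ℝ) {t : ℝ} (ht : 0 < t) (x : Amb n) :
    homExt f (t • x) = homExt f x := by
  by_cases hx : x = 0
  · simp [hx]
  · rw [homExt_eq hx, homExt_eq (smul_ne_zero ht.ne' hx)]
    congr 1
    exact Subtype.ext (dir_smul ht x)

theorem contDiffAt_homExt {f : Sph n → ℝ} {m : WithTop ℕ∞} (hf : ContMDiff (𝓡 n) 𝓘(ℝ, ℝ) m f)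
    {x : Amb n} (hx : x ≠ 0) : ContDiffAt ℝ m (homExt f) x := by
  let U : TopologicalSpace.Opens (Amb n) := ⟨{0}ᶜ, isOpen_compl_singleton⟩
  have hdir : ContMDiff 𝓘(ℝ, Amb n) 𝓘(ℝ, Amb n) m (fun y : U => dir (y : Amb n)) := by
    intro y
    exact contMDiffAt_subtype_iff.2 (contDiffAt_dir y.2).contMDiffAt
  have : Fact (Module.finrank ℝ (Amb n) = n + 1) := ⟨by simp⟩
  have h1 := hdir.codRestrict_sphere (n := n) fun y => by simpa using norm_dir y.2
  have h2 := hf.comp h1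
  have h3 : ContMDiffAt 𝓘(ℝ, Amb n) 𝓘(ℝ, ℝ) m (fun y : U => homExt f y) ⟨x, hx⟩ := by
    refine (h2 ⟨x, hx⟩).congr_of_eventuallyEq (Filter.Eventually.of_forall fun y => ?_)
    exact homExt_eq y.2
  exact (contMDiffAt_subtype_iff.1 h3).contDiffAt

end SphericalCoordinates

/-! ### Derivatives along lines -/

section Lines

variable {E F : Type*} [NormedAddCommGroup E] [NormedSpace ℝ E] [NormedAddCommGroup F]
  [NormedSpace ℝ F]

theorem hasDerivAt_line (z X : E) (t : ℝ) : HasDerivAt (fun t : ℝ => z + t • X) X t := by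
  simpa using ((hasDerivAt_id t).smul_const X).const_add z

theorem HasFDerivAt.hasDerivAt_line {f : E → F} {f' : E →L[ℝ] F} {z : E}
    (h : HasFDerivAt f f' z) (X : E) : HasDerivAt (fun t : ℝ => f (z + t • X)) (f' X) 0 := by
  have h' : HasFDerivAt f f' (z + (0 : ℝ) • X) := by simpa using h
  exact h'.comp_hasDerivAt (0 : ℝ) (_root_.hasDerivAt_line z X 0)

theorem DifferentiableAt.hasDerivAt_line {f : E → F} {z : E}
    (h : DifferentiableAt ℝ f z) (X : E) :
    HasDerivAt (fun t : ℝ => f (z + t • X)) (fderiv ℝ f z X) 0 :=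
  h.hasFDerivAt.hasDerivAt_line X

theorem ContDiffAt.differentiableAt_fderiv {f : E → F} {z : E} {m : WithTop ℕ∞}
    (hf : ContDiffAt ℝ m f z) (hm : 2 ≤ m) : DifferentiableAt ℝ (fderiv ℝ f) z :=
  (hf.fderiv_right (m := 1) (by simpa [one_add_one_eq_two] using hm)).differentiableAt (by simp)

theorem ContDiffAt.hasDerivAt_fderiv_line {f : E → F} {z : E} {m : WithTop ℕ∞}
    (hf : ContDiffAt ℝ m f z) (hm : 2 ≤ m) (X Y : E) :
    HasDerivAt (fun t : ℝ => fderiv ℝ f (z + t • X) Y) (fderiv ℝ (fderiv ℝ f) z X Y) 0 := by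
  have h := ((hf.differentiableAt_fderiv hm).hasDerivAt_line X).clm_apply (hasDerivAt_const 0 Y)
  simpa using h

theorem eventually_line_ne {z : E} (hz : z ≠ 0) (X : E) : ∀ᶠ t in nhds (0 : ℝ), z + t • X ≠ 0 := by
  have hc : ContinuousAt (fun t : ℝ => z + t • X) 0 := (hasDerivAt_line z X 0).continuousAt
  exact hc.eventually_ne (by simpa using hz)

end Lines

/-! ### The geometry of a radial graph -/

section RadialGraph

variable {n : ℕ} (N : SpaceForm)

theorem sphere_norm (z : Sph n) : ‖(z : Amb n)‖ = 1 := by simp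

theorem sphere_ne_zero (z : Sph n) : (z : Amb n) ≠ 0 :=
  norm_ne_zero_iff.1 (by rw [sphere_norm]; exact one_ne_zero)

theorem metricN_eq {x : Amb n} (hx : x ≠ 0) (v w : Amb n) :
    metricN N x v w = (1 - (N.phi ‖x‖ / ‖x‖) ^ 2) * (inner ℝ (dir x) v * inner ℝ (dir x) w) +
      (N.phi ‖x‖ / ‖x‖) ^ 2 * inner ℝ v w := by
  have h1 : (inner ℝ (dir x) (dir x) : ℝ) = 1 := by
    rw [real_inner_self_eq_norm_sq, norm_dir hx]; norm_num
  have hx' : ‖x‖ ≠ 0 := norm_ne_zero_iff.2 hx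
  simp only [metricN, dZ, dRho, inner_smul_left, inner_smul_right, inner_sub_left,
    inner_sub_right, h1, RCLike.conj_to_real, real_inner_comm (dir x) v]
  field_simp
  ring

theorem differentiableAt_metricN {x : Amb n} (hx : x ≠ 0) (v w : Amb n) :
    DifferentiableAt ℝ (fun p => metricN N p v w) x := by
  have h1 : DifferentiableAt ℝ (dir : Amb n → Amb n) x :=
    (contDiffAt_dir hx (m := 1)).differentiableAt (by simp)
  have h2 : DifferentiableAt ℝ (fun p : Amb n => ‖p‖) x :=
    (hasFDerivAt_norm_amb hx).differentiableAt
  have h3 : DifferentiableAt ℝ (fun p : Amb n => N.phi ‖p‖) x :=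
    (N.hasDerivAt_phi _).differentiableAt.comp x h2
  have h4 : DifferentiableAt ℝ (fun p : Amb n => ‖p‖⁻¹) x := h2.inv (norm_ne_zero_iff.2 hx)
  have h5 : ∀ u : Amb n, DifferentiableAt ℝ (fun p => dRho p u) x := fun u =>
    h1.inner ℝ (differentiableAt_const u)
  have h6 : ∀ u : Amb n, DifferentiableAt ℝ (fun p => dZ p u) x := fun u =>
    h4.smul ((differentiableAt_const u).sub ((h5 u).smul h1))
  exact ((h5 v).mul (h5 w)).add ((h3.pow 2).mul ((h6 v).inner ℝ (h6 w)))

/-- The derivative of the metric coefficients of `g^N` at the point at distance `R` from the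
origin in direction `z`. -/
theorem fderiv_metricN {z : Amb n} (hz : ‖z‖ = 1) {R : ℝ} (hR : 0 < R) (v w y : Amb n) :
    fderiv ℝ (fun p => metricN N p v w) (R • z) y =
      2 * (N.phi R / R) * ((N.dphi R * R - N.phi R) / R ^ 2) * inner ℝ z y *
        (inner ℝ v w - inner ℝ z v * inner ℝ z w) +
      (1 - (N.phi R / R) ^ 2) * R⁻¹ * ((inner ℝ y v - inner ℝ z y * inner ℝ z v) * inner ℝ z w +
        inner ℝ z v * (inner ℝ y w - inner ℝ z y * inner ℝ z w)) := by
  have hz0 : z ≠ 0 := norm_ne_zero_iff.1 (by rw [hz]; exact one_ne_zero)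
  have hx : R • z ≠ 0 := smul_ne_zero hR.ne' hz0
  have hdir : dir (R • z) = z := by rw [dir_smul hR, dir_of_norm_one hz]
  have hnorm : ‖R • z‖ = R := by rw [norm_smul, hz, Real.norm_of_nonneg hR.le, mul_one]
  have h0 := (differentiableAt_metricN N hx v w).hasDerivAt_line y
  refine h0.unique ?_
  have hd : HasDerivAt (fun t : ℝ => dir (R • z + t • y)) (R⁻¹ • (y - (inner ℝ z y : ℝ) • z)) 0 := by
    have := ((contDiffAt_dir hx (m := 1)).differentiableAt (by simp)).hasDerivAt_line y
    rwa [fderiv_dir hx, dZ, dRho, hdir, hnorm] at this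
  have hn : HasDerivAt (fun t : ℝ => ‖R • z + t • y‖) (inner ℝ z y) 0 := by
    have := (hasFDerivAt_norm_amb hx).hasDerivAt_line y
    rwa [hdir] at this
  have hn0 : ‖R • z + (0 : ℝ) • y‖ = R := by rw [zero_smul, add_zero, hnorm]
  have hd0 : dir (R • z + (0 : ℝ) • y) = z := by rw [zero_smul, add_zero, hdir]
  have hphi : HasDerivAt (fun t : ℝ => N.phi ‖R • z + t • y‖) (N.dphi R * inner ℝ z y) 0 := by
    have h := N.hasDerivAt_phi ‖R • z + (0 : ℝ) • y‖
    rw [hn0] at h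
    exact HasDerivAt.comp (0 : ℝ) (by rwa [hn0]) hn
  have hq := ((hphi.div hn (by rw [hn0]; exact hR.ne')).pow 2)
  have hv := hd.inner ℝ (hasDerivAt_const (0 : ℝ) v)
  have hw := hd.inner ℝ (hasDerivAt_const (0 : ℝ) w)
  have htot := ((hq.const_sub 1).mul (hv.mul hw)).add (hq.mul_const (inner ℝ v w))
  have hev : (fun t : ℝ => metricN N (R • z + t • y) v w) =ᶠ[nhds 0] _ :=
    (eventually_line_ne hx y).mono fun t ht => metricN_eq N ht v w
  refine (htot.congr_of_eventuallyEq hev).congr_deriv ?_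
  simp only [Pi.pow_apply, Pi.div_apply, Pi.mul_apply, hn0, hd0, inner_zero_right, zero_add,
    inner_smul_left, inner_sub_left, RCLike.conj_to_real]
  norm_num
  field_simp
  ring

variable {ρ : Sph n → ℝ} {z : Sph n}

theorem radialGraph_sphere (ρ : Sph n → ℝ) (z : Sph n) :
    radialGraph ρ z = ρ z • (z : Amb n) := by
  rw [radialGraph, homExt_sphere, dir_of_norm_one (sphere_norm z)]

theorem dir_radialGraph (hρ : 0 < ρ z) : dir (radialGraph ρ z) = (z : Amb n) := by
  rw [radialGraph_sphere, dir_smul hρ, dir_of_norm_one (sphere_norm z)]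

theorem norm_radialGraph (hρ : 0 < ρ z) : ‖radialGraph ρ z‖ = ρ z := by
  rw [radialGraph_sphere, norm_smul, sphere_norm, Real.norm_of_nonneg hρ.le, mul_one]

theorem metricN_radialGraph (hρ : 0 < ρ z) (v w : Amb n) :
    metricN N (radialGraph ρ z) v w =
      (1 - (N.phi (ρ z) / ρ z) ^ 2) * (inner ℝ (z : Amb n) v * inner ℝ (z : Amb n) w) +
        (N.phi (ρ z) / ρ z) ^ 2 * inner ℝ v w := by
  rw [metricN_eq, dir_radialGraph hρ, norm_radialGraph hρ]
  rw [radialGraph_sphere]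
  exact smul_ne_zero hρ.ne' (sphere_ne_zero z)

theorem fderiv_radialGraph {x : Amb n} (hx : x ≠ 0) (h : DifferentiableAt ℝ (homExt ρ) x)
    (Y : Amb n) : fderiv ℝ (radialGraph ρ) x Y =
      homExt ρ x • dZ x Y + fderiv ℝ (homExt ρ) x Y • dir x := by
  have hd : DifferentiableAt ℝ (dir : Amb n → Amb n) x :=
    (contDiffAt_dir hx (m := 1)).differentiableAt (by simp)
  have := h.hasFDerivAt.smul hd.hasFDerivAt
  rw [show radialGraph ρ = homExt ρ • dir from funext fun _ => rfl, this.fderiv]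
  simp [fderiv_dir hx]

theorem pushTangent_eq (h : DifferentiableAt ℝ (homExt ρ) (z : Amb n)) {X : Amb n}
    (hX : inner ℝ (z : Amb n) X = 0) : pushTangent ρ z X =
      ρ z • X + fderiv ℝ (homExt ρ) (z : Amb n) X • (z : Amb n) := by
  rw [pushTangent, fderiv_radialGraph (sphere_ne_zero z) h, homExt_sphere, dZ, dRho,
    dir_of_norm_one (sphere_norm z), hX, sphere_norm]
  simp

theorem hasDerivAt_dir_line {X : Amb n} (hX : inner ℝ (z : Amb n) X = 0) :
    HasDerivAt (fun t : ℝ => dir ((z : Amb n) + t • X)) X 0 := by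
  have := ((contDiffAt_dir (sphere_ne_zero z) (m := 1)).differentiableAt
    (by simp)).hasDerivAt_line X
  rwa [fderiv_dir (sphere_ne_zero z), dZ, dRho, dir_of_norm_one (sphere_norm z), hX, sphere_norm,
    zero_smul, sub_zero, inv_one, one_smul] at this

theorem hasDerivAt_norm_line {X : Amb n} (hX : inner ℝ (z : Amb n) X = 0) :
    HasDerivAt (fun t : ℝ => ‖(z : Amb n) + t • X‖) 0 0 := by
  have := (hasFDerivAt_norm_amb (sphere_ne_zero z)).hasDerivAt_line X
  rwa [innerSL_apply_apply, dir_of_norm_one (sphere_norm z), hX] at this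

theorem fderiv_fderiv_radialGraph (h : ContDiffAt ℝ 3 (homExt ρ) (z : Amb n)) {X Y : Amb n}
    (hX : inner ℝ (z : Amb n) X = 0) (hY : inner ℝ (z : Amb n) Y = 0) :
    fderiv ℝ (fderiv ℝ (radialGraph ρ)) (z : Amb n) X Y =
      (fderiv ℝ (fderiv ℝ (homExt ρ)) (z : Amb n) X Y - ρ z * inner ℝ X Y) • (z : Amb n)
      + fderiv ℝ (homExt ρ) (z : Amb n) X • Y + fderiv ℝ (homExt ρ) (z : Amb n) Y • X := by
  have hz0 := sphere_ne_zero z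
  have hF : ContDiffAt ℝ 3 (radialGraph ρ) (z : Amb n) := h.smul (contDiffAt_dir hz0)
  refine (hF.hasDerivAt_fderiv_line (by norm_num) X Y).unique ?_
  have hd := hasDerivAt_dir_line hX
  have hn := hasDerivAt_norm_line hX
  have hr := (h.differentiableAt (by simp)).hasDerivAt_line X
  have hrY := h.hasDerivAt_fderiv_line (by norm_num) X Y
  have hdZ := (hn.inv (by simp)).smul
    ((hasDerivAt_const (0 : ℝ) Y).sub ((hd.inner ℝ (hasDerivAt_const (0 : ℝ) Y)).smul hd))
  have htot := (hr.smul hdZ).add (hrY.smul hd)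
  have hdiff : ∀ᶠ x in nhds (z : Amb n), DifferentiableAt ℝ (homExt ρ) x := by
    have h1 : ContDiffAt ℝ 1 (homExt ρ) (z : Amb n) := h.of_le (by norm_num)
    exact (h1.eventually (by simp)).mono fun x hx => hx.differentiableAt (by simp)
  have hcont : Filter.Tendsto (fun t : ℝ => (z : Amb n) + t • X) (nhds 0) (nhds (z : Amb n)) := by
    have := (hasDerivAt_line (z : Amb n) X 0).continuousAt
    simpa [ContinuousAt] using this
  have hev : (fun t : ℝ => fderiv ℝ (radialGraph ρ) ((z : Amb n) + t • X) Y) =ᶠ[nhds 0] _ :=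
    ((eventually_line_ne hz0 X).and (hcont.eventually hdiff)).mono fun t ht =>
      fderiv_radialGraph ht.1 ht.2 Y
  refine (htot.congr_of_eventuallyEq hev).congr_deriv ?_
  simp only [zero_smul, add_zero, dir_of_norm_one (sphere_norm z), sphere_norm, hY, Pi.inv_apply,
    Pi.smul_apply', Pi.sub_apply, homExt_sphere, inner_zero_right, zero_add]
  simp
  module

theorem inner_self_sphere (z : Sph n) : (inner ℝ (z : Amb n) (z : Amb n) : ℝ) = 1 := by
  rw [real_inner_self_eq_norm_sq, sphere_norm]; norm_num

theorem IsOuterUnitNormal.inner_tangent (hρ : 0 < ρ z) (hφ : N.phi (ρ z) ≠ 0)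
    (h : DifferentiableAt ℝ (homExt ρ) (z : Amb n)) {ν : Amb n} (hν : IsOuterUnitNormal N ρ z ν)
    {W : Amb n} (hW : inner ℝ (z : Amb n) W = 0) : (inner ℝ W ν : ℝ) =
      -(ρ z / N.phi (ρ z) ^ 2) * inner ℝ (z : Amb n) ν * fderiv ℝ (homExt ρ) (z : Amb n) W := by
  have h1 := hν.normal W hW
  rw [metricN_radialGraph N hρ, pushTangent_eq h hW] at h1
  simp only [inner_add_right, inner_smul_right, hW, inner_self_sphere,
    real_inner_comm (z : Amb n) ν, real_inner_comm W ν] at h1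
  field_simp at h1 ⊢
  refine mul_left_cancel₀ hρ.ne' ?_
  linear_combination h1

theorem secondFF_eq (hρ : 0 < ρ z) (hφ : N.phi (ρ z) ≠ 0)
    (h : ContDiffAt ℝ 3 (homExt ρ) (z : Amb n)) {ν : Amb n} (hν : IsOuterUnitNormal N ρ z ν)
    {X Y : Amb n} (hX : inner ℝ (z : Amb n) X = 0) (hY : inner ℝ (z : Amb n) Y = 0) :
    secondFF N ρ z ν X Y = inner ℝ (z : Amb n) ν *
      (-fderiv ℝ (fderiv ℝ (homExt ρ)) (z : Amb n) X Y
        + 2 * N.cot (ρ z) * (fderiv ℝ (homExt ρ) (z : Amb n) X * fderiv ℝ (homExt ρ) (z : Amb n) Y)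
        + N.phi (ρ z) * N.dphi (ρ z) * inner ℝ X Y) := by
  have hdiff := h.differentiableAt (by simp)
  have hzz := inner_self_sphere z
  have eX := hν.inner_tangent N hρ hφ hdiff hX
  have eY := hν.inner_tangent N hρ hφ hdiff hY
  rw [secondFF, christoffelN, metricN_radialGraph N hρ, fderiv_fderiv_radialGraph h hX hY,
    pushTangent_eq hdiff hX, pushTangent_eq hdiff hY, radialGraph_sphere]
  simp only [fderiv_metricN N (sphere_norm z) hρ]
  have hX' : inner ℝ X (z : Amb n) = 0 := by rw [real_inner_comm]; exact hX
  have hY' : inner ℝ Y (z : Amb n) = 0 := by rw [real_inner_comm]; exact hY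
  simp only [inner_add_right, inner_smul_right, inner_add_left, inner_smul_left, hX, hY, hzz,
    RCLike.conj_to_real, hX', hY', eX, eY, real_inner_comm (z : Amb n) ν, real_inner_comm Y X,
    real_inner_comm X ν, real_inner_comm Y ν, SpaceForm.cot]
  field_simp
  ring

end RadialGraph

/-! ### Gauge functions -/

section Gauge

variable {V : Type*} [NormedAddCommGroup V] [InnerProductSpace ℝ V] [FiniteDimensional ℝ V]

/-- A `C³` function on `V ∖ {0}`, positively homogeneous of degree one. -/
structure IsGauge (s : V → ℝ) : Prop where
  contDiffAt : ∀ x, x ≠ 0 → ContDiffAt ℝ 3 s x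
  smul : ∀ t : ℝ, 0 < t → ∀ x, s (t • x) = t * s x

/-- The component of the gradient of a gauge `s` which is tangent to the unit sphere at the unit
vector `z`; it is the spherical gradient of `s`. -/
noncomputable def tangGrad (s : V → ℝ) (z : V) : V := gradient s z - s z • z

/-- The function `|∇s|² + K`. For the gauge of a radial graph it is `u⁻²`, where `u` is the support
function. -/
noncomputable def energy (K : ℝ) (s : V → ℝ) (z : V) : ℝ := ‖gradient s z‖ ^ 2 + K

/-- The operator `(1 - E⁻¹ τ ⊗ τ) ∘ D²s`, with `τ` the spherical gradient of `s` and
`E = |∇s|² + K`. For the gauge of a radial graph it is a multiple of the Weingarten map in the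
tangent space of the sphere, and vanishes on the radial direction. -/
noncomputable def shapeOp (K : ℝ) (s : V → ℝ) (z : V) : V →L[ℝ] V :=
  (1 - (energy K s z)⁻¹ • (innerSL ℝ (tangGrad s z)).smulRight (tangGrad s z)) ∘L
    fderiv ℝ (gradient s) z

theorem shapeOp_apply (K : ℝ) (s : V → ℝ) (z X : V) :
    shapeOp K s z X = fderiv ℝ (gradient s) z X -
      ((energy K s z)⁻¹ * inner ℝ (tangGrad s z) (fderiv ℝ (gradient s) z X)) • tangGrad s z := by
  simp [shapeOp, smul_smul]

theorem inner_gradient_eq (s : V → ℝ) (x Y : V) : inner ℝ (gradient s x) Y = fderiv ℝ s x Y := by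
  simp [gradient]

namespace IsGauge

variable {s : V → ℝ} (hs : IsGauge s) {x : V}

include hs

theorem contDiffAt_gradient (hx : x ≠ 0) : ContDiffAt ℝ 2 (gradient s) x := by
  have h := (hs.contDiffAt x hx).fderiv_right (m := 2) (by norm_num)
  exact (InnerProductSpace.toDual ℝ V).symm.toContinuousLinearEquiv.contDiff.contDiffAt.comp x h

theorem differentiableAt_gradient (hx : x ≠ 0) : DifferentiableAt ℝ (gradient s) x :=
  (hs.contDiffAt_gradient hx).differentiableAt (by simp)

theorem differentiableAt_hess (hx : x ≠ 0) : DifferentiableAt ℝ (fderiv ℝ (gradient s)) x :=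
  (hs.contDiffAt_gradient hx).differentiableAt_fderiv le_rfl

theorem inner_hess (hx : x ≠ 0) (X Y : V) :
    inner ℝ (fderiv ℝ (gradient s) x X) Y = fderiv ℝ (fderiv ℝ s) x X Y := by
  have h1 := ((hs.differentiableAt_gradient hx).hasDerivAt_line X).inner ℝ
    (hasDerivAt_const (0 : ℝ) Y)
  have h2 := (hs.contDiffAt x hx).hasDerivAt_fderiv_line (by norm_num) X Y
  simp only [inner_gradient_eq, inner_zero_right, zero_add] at h1
  exact h1.unique h2

theorem inner_hess_symm (hx : x ≠ 0) (X Y : V) :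
    (inner ℝ (fderiv ℝ (gradient s) x X) Y : ℝ) = inner ℝ (fderiv ℝ (gradient s) x Y) X := by
  rw [hs.inner_hess hx, hs.inner_hess hx]
  exact (hs.contDiffAt x hx).isSymmSndFDerivAt (by simp; norm_num) X Y

theorem gradient_smul {t : ℝ} (ht : 0 < t) (hx : x ≠ 0) : gradient s (t • x) = gradient s x := by
  refine ext_inner_right ℝ fun Y => ?_
  rw [inner_gradient_eq, inner_gradient_eq]
  have h1 := ((hs.contDiffAt (t • x) (smul_ne_zero ht.ne' hx)).differentiableAt
    (by simp)).hasFDerivAt.comp x ((hasFDerivAt_id x).const_smul t)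
  have h2 := ((hs.contDiffAt x hx).differentiableAt (by simp)).hasFDerivAt.const_mul t
  have h3 : s ∘ (fun y => t • id y) = fun y => t * s y := funext fun y => hs.smul t ht y
  have h4 : HasFDerivAt (s ∘ (fun y => t • id y)) _ x := h1
  rw [h3] at h4
  have h5 := congrArg (fun L : V →L[ℝ] ℝ => L Y) (h4.unique h2)
  simp only [ContinuousLinearMap.comp_apply, smul_apply, ContinuousLinearMap.id_apply, map_smul,
    smul_eq_mul] at h5
  exact mul_left_cancel₀ ht.ne' h5

theorem inner_gradient_self (hx : x ≠ 0) : inner ℝ (gradient s x) x = s x := by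
  rw [inner_gradient_eq]
  have h1 := ((hs.contDiffAt x hx).differentiableAt (by simp)).hasDerivAt_line x
  have h2 : HasDerivAt (fun t : ℝ => (1 + t) * s x) (s x) 0 := by
    simpa using ((hasDerivAt_id (0 : ℝ)).const_add 1).mul_const (s x)
  refine h1.unique (h2.congr_of_eventuallyEq ?_)
  filter_upwards [lt_mem_nhds (show (-1 : ℝ) < 0 by norm_num)] with t ht
  rw [← hs.smul (1 + t) (by linarith), add_smul, one_smul]

theorem hess_self (hx : x ≠ 0) : fderiv ℝ (gradient s) x x = 0 := by
  have h1 := (hs.differentiableAt_gradient hx).hasDerivAt_line x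
  refine h1.unique ((hasDerivAt_const (0 : ℝ) (gradient s x)).congr_of_eventuallyEq ?_)
  filter_upwards [lt_mem_nhds (show (-1 : ℝ) < 0 by norm_num)] with t ht
  rw [← hs.gradient_smul (t := 1 + t) (by linarith) hx, add_smul, one_smul]

theorem inner_hess_self (hx : x ≠ 0) (X : V) : inner ℝ x (fderiv ℝ (gradient s) x X) = (0 : ℝ) := by
  rw [real_inner_comm, hs.inner_hess_symm hx, hs.hess_self hx, inner_zero_left]

theorem third_symm (hx : x ≠ 0) (X Y : V) :
    fderiv ℝ (fderiv ℝ (gradient s)) x X Y = fderiv ℝ (fderiv ℝ (gradient s)) x Y X :=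
  (hs.contDiffAt_gradient hx).isSymmSndFDerivAt (by simp) X Y

theorem hasDerivAt_hess_line (hx : x ≠ 0) (X Y : V) :
    HasDerivAt (fun t : ℝ => fderiv ℝ (gradient s) (x + t • X) Y)
      (fderiv ℝ (fderiv ℝ (gradient s)) x X Y) 0 :=
  (hs.contDiffAt_gradient hx).hasDerivAt_fderiv_line le_rfl X Y

theorem inner_third_symm (hx : x ≠ 0) (X Y Z : V) :
    (inner ℝ (fderiv ℝ (fderiv ℝ (gradient s)) x X Y) Z : ℝ) =
      inner ℝ (fderiv ℝ (fderiv ℝ (gradient s)) x X Z) Y := by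
  have h1 := (hs.hasDerivAt_hess_line hx X Y).inner ℝ (hasDerivAt_const (0 : ℝ) Z)
  have h2 := (hs.hasDerivAt_hess_line hx X Z).inner ℝ (hasDerivAt_const (0 : ℝ) Y)
  simp only [inner_zero_right, zero_add] at h1 h2
  refine h1.unique (h2.congr_of_eventuallyEq ?_)
  filter_upwards [eventually_line_ne hx X] with t ht
  exact hs.inner_hess_symm ht Y Z

/-- The derivative of the relation `D²s(y) y = 0`. -/
theorem third_self (hx : x ≠ 0) (X : V) :
    fderiv ℝ (fderiv ℝ (gradient s)) x X x = -fderiv ℝ (gradient s) x X := by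
  have h1 := ((hs.differentiableAt_hess hx).hasDerivAt_line X).clm_apply (hasDerivAt_line x X 0)
  have h2 : HasDerivAt (fun t : ℝ => fderiv ℝ (gradient s) (x + t • X) (x + t • X)) 0 0 := by
    refine (hasDerivAt_const (0 : ℝ) (0 : V)).congr_of_eventuallyEq ?_
    filter_upwards [eventually_line_ne hx X] with t ht
    exact hs.hess_self ht
  have h3 := h1.unique h2
  simp only [zero_smul, add_zero] at h3
  exact eq_neg_of_add_eq_zero_left h3

theorem inner_self_tangGrad (hx : ‖x‖ = 1) : inner ℝ x (tangGrad s x) = (0 : ℝ) := by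
  have h0 : x ≠ 0 := norm_ne_zero_iff.1 (by rw [hx]; exact one_ne_zero)
  rw [tangGrad, inner_sub_right, inner_smul_right, real_inner_comm, hs.inner_gradient_self h0,
    real_inner_self_eq_norm_sq, hx]
  ring

theorem inner_gradient_tangGrad (hx : ‖x‖ = 1) :
    inner ℝ (gradient s x) (tangGrad s x) = ‖tangGrad s x‖ ^ 2 := by
  have h : gradient s x = tangGrad s x + s x • x := by rw [tangGrad]; abel
  rw [h, inner_add_left, inner_smul_left, hs.inner_self_tangGrad hx, real_inner_self_eq_norm_sq]
  simp

theorem energy_eq (K : ℝ) (hx : ‖x‖ = 1) :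
    energy K s x = ‖tangGrad s x‖ ^ 2 + (s x ^ 2 + K) := by
  have h : gradient s x = tangGrad s x + s x • x := by rw [tangGrad]; abel
  rw [energy, h, norm_add_sq_real, inner_smul_right, real_inner_comm, hs.inner_self_tangGrad hx,
    norm_smul, hx, mul_one, Real.norm_eq_abs, sq_abs]
  ring

end IsGauge

end Gauge

/-! ### The gauge of a radial graph -/

section GaugeOfGraph

variable {n : ℕ} (N : SpaceForm)

/-- The positively homogeneous function of degree one which equals `φ'(ρ) / φ(ρ)` on the unit
sphere. In the geodesic (central) projection of the space form to `ℝ^{n+1}`, it is the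
Minkowski gauge of the star-shaped domain bounded by the radial graph of `ρ`. -/
noncomputable def gaugeFn (ρ : Sph n → ℝ) (x : Amb n) : ℝ := ‖x‖ * N.cot (homExt ρ x)

variable {N} {ρ : Sph n → ℝ} {z : Sph n}

theorem gaugeFn_sphere : gaugeFn N ρ z = N.cot (ρ z) := by
  rw [gaugeFn, homExt_sphere, sphere_norm, one_mul]

theorem phi_homExt_ne_zero (hφ : ∀ z, N.phi (ρ z) ≠ 0) {x : Amb n} (hx : x ≠ 0) :
    N.phi (homExt ρ x) ≠ 0 := by
  rw [homExt_eq hx]; exact hφ _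

theorem isGauge_gaugeFn (hρ : ContMDiff (𝓡 n) 𝓘(ℝ, ℝ) 3 ρ) (hφ : ∀ z, N.phi (ρ z) ≠ 0) :
    IsGauge (gaugeFn N ρ) where
  contDiffAt x hx := (contDiffAt_norm ℝ hx).mul
    ((N.contDiffAt_cot (phi_homExt_ne_zero hφ hx)).comp x (contDiffAt_homExt hρ hx))
  smul t ht x := by
    rw [gaugeFn, gaugeFn, homExt_smul ρ ht, norm_smul, Real.norm_of_nonneg ht.le, mul_assoc]

theorem fderiv_gaugeFn {x : Amb n} (hx : x ≠ 0) (h : DifferentiableAt ℝ (homExt ρ) x)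
    (hφ : N.phi (homExt ρ x) ≠ 0) (Y : Amb n) :
    fderiv ℝ (gaugeFn N ρ) x Y = dRho x Y * N.cot (homExt ρ x) -
      ‖x‖ * ((N.phi (homExt ρ x) ^ 2)⁻¹ * fderiv ℝ (homExt ρ) x Y) := by
  have h1 := (N.hasDerivAt_cot hφ).comp_hasFDerivAt x h.hasFDerivAt
  have h2 := (hasFDerivAt_norm_amb hx).mul h1
  rw [show gaugeFn N ρ = (fun y => ‖y‖) * (N.cot ∘ homExt ρ) from rfl, h2.fderiv]
  simp only [add_apply, smul_apply, innerSL_apply_apply, smul_eq_mul, Function.comp_apply, dRho]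
  ring

theorem tangGrad_gaugeFn (h : DifferentiableAt ℝ (homExt ρ) (z : Amb n))
    (hφ : N.phi (ρ z) ≠ 0) :
    tangGrad (gaugeFn N ρ) (z : Amb n) = -(N.phi (ρ z) ^ 2)⁻¹ • sphGrad ρ z := by
  refine ext_inner_right ℝ fun Y => ?_
  rw [tangGrad, inner_sub_left, inner_smul_left, inner_smul_left, inner_gradient_eq, sphGrad,
    inner_gradient_eq, fderiv_gaugeFn (sphere_ne_zero z) h (by rwa [homExt_sphere]), dRho,
    dir_of_norm_one (sphere_norm z), homExt_sphere, gaugeFn_sphere, sphere_norm]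
  simp only [RCLike.conj_to_real]
  ring

theorem fderiv_fderiv_gaugeFn (h : ContDiffAt ℝ 3 (homExt ρ) (z : Amb n))
    (hφ : N.phi (ρ z) ≠ 0) {X Y : Amb n} (hX : inner ℝ (z : Amb n) X = 0)
    (hY : inner ℝ (z : Amb n) Y = 0) :
    fderiv ℝ (fderiv ℝ (gaugeFn N ρ)) (z : Amb n) X Y =
      N.cot (ρ z) * inner ℝ X Y - (N.phi (ρ z) ^ 2)⁻¹ *
        (fderiv ℝ (fderiv ℝ (homExt ρ)) (z : Amb n) X Y - 2 * N.cot (ρ z) *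
          (fderiv ℝ (homExt ρ) (z : Amb n) X * fderiv ℝ (homExt ρ) (z : Amb n) Y)) := by
  have hz0 := sphere_ne_zero z
  have hφ' : N.phi (homExt ρ z) ≠ 0 := by rwa [homExt_sphere]
  have hF : ContDiffAt ℝ 3 (gaugeFn N ρ) (z : Amb n) :=
    (contDiffAt_norm ℝ hz0).mul ((N.contDiffAt_cot hφ').comp _ h)
  refine (hF.hasDerivAt_fderiv_line (by norm_num) X Y).unique ?_
  have hd := hasDerivAt_dir_line hX
  have hn := hasDerivAt_norm_line hX
  have hr := (h.differentiableAt (by simp)).hasDerivAt_line X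
  have hrY := h.hasDerivAt_fderiv_line (by norm_num) X Y
  have h00 : homExt ρ ((z : Amb n) + (0 : ℝ) • X) = ρ z := by
    rw [zero_smul, add_zero, homExt_sphere]
  have hcot := HasDerivAt.comp (0 : ℝ) (by rw [h00]; exact N.hasDerivAt_cot hφ) hr
  have hphi := HasDerivAt.comp (0 : ℝ) (by rw [h00]; exact N.hasDerivAt_phi (ρ z)) hr
  have hinv := (hphi.pow 2).inv (by simpa [homExt_sphere] using hφ)
  have htot := ((hd.inner ℝ (hasDerivAt_const (0 : ℝ) Y)).mul hcot).sub (hn.mul (hinv.mul hrY))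
  have hdiff : ∀ᶠ x in nhds (z : Amb n),
      DifferentiableAt ℝ (homExt ρ) x ∧ N.phi (homExt ρ x) ≠ 0 := by
    have h1 : ContDiffAt ℝ 1 (homExt ρ) (z : Amb n) := h.of_le (by norm_num)
    refine ((h1.eventually (by simp)).mono fun x hx => hx.differentiableAt (by simp)).and ?_
    have hc : ContinuousAt (fun x => N.phi (homExt ρ x)) (z : Amb n) :=
      (N.hasDerivAt_phi _).continuousAt.comp h.continuousAt
    exact hc.eventually_ne hφ'
  have hcont : Filter.Tendsto (fun t : ℝ => (z : Amb n) + t • X) (nhds 0) (nhds (z : Amb n)) := by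
    have := (hasDerivAt_line (z : Amb n) X 0).continuousAt
    simpa [ContinuousAt] using this
  have hev : (fun t : ℝ => fderiv ℝ (gaugeFn N ρ) ((z : Amb n) + t • X) Y) =ᶠ[nhds 0] _ :=
    ((eventually_line_ne hz0 X).and (hcont.eventually hdiff)).mono fun t ht =>
      fderiv_gaugeFn ht.1 ht.2.1 ht.2.2 Y
  refine (htot.congr_of_eventuallyEq hev).congr_deriv ?_
  simp only [zero_smul, add_zero, dir_of_norm_one (sphere_norm z), sphere_norm, hY, Pi.inv_apply,
    Pi.pow_apply, Pi.mul_apply, Function.comp_apply, homExt_sphere, inner_zero_right, zero_add,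
    SpaceForm.cot]
  norm_num
  field_simp
  ring

end GaugeOfGraph

/-! ### Normal, support function and curvatures of a radial graph in terms of its gauge -/

open Polynomial in
/-- The generating polynomial is unchanged by adjoining the entry zero. -/
theorem genPoly_cons_zero {n : ℕ} (μ : Fin n → ℝ) :
    genPoly Finset.univ (Fin.cons 0 μ : Fin (n + 1) → ℝ) = genPoly Finset.univ μ := by
  simp [genPoly, Fin.prod_univ_succ]

theorem genPoly_smul_coeff {ι : Type*} (s : Finset ι) (c : ℝ) (μ : ι → ℝ) (j : ℕ) :
    (genPoly s fun i => c * μ i).coeff j = c ^ j * (genPoly s μ).coeff j := by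
  rw [coeff_genPoly, coeff_genPoly, Finset.mul_sum]
  refine Finset.sum_congr rfl fun t ht => ?_
  rw [Finset.prod_mul_distrib, Finset.prod_const, (Finset.mem_powersetCard.1 ht).2]

section GraphGeometry

variable {n : ℕ} {N : SpaceForm} {ρ : Sph n → ℝ} {z : Sph n} {ν : Amb n}

/-- The factor `φ √E`, by which the Weingarten map of the graph has to be multiplied to give the
shape operator of the gauge. -/
noncomputable def shapeScale (N : SpaceForm) (ρ : Sph n → ℝ) (z : Sph n) : ℝ :=
  N.phi (ρ z) * √(energy N.curv (gaugeFn N ρ) (z : Amb n))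

theorem energy_gaugeFn (hs : IsGauge (gaugeFn N ρ)) (hφ : N.phi (ρ z) ≠ 0) :
    energy N.curv (gaugeFn N ρ) (z : Amb n) =
      ‖tangGrad (gaugeFn N ρ) (z : Amb n)‖ ^ 2 + (N.phi (ρ z) ^ 2)⁻¹ := by
  rw [hs.energy_eq _ (sphere_norm z), gaugeFn_sphere, N.cot_sq_add hφ]

theorem energy_gaugeFn_pos (hs : IsGauge (gaugeFn N ρ)) (hφ : N.phi (ρ z) ≠ 0) :
    0 < energy N.curv (gaugeFn N ρ) (z : Amb n) := by
  rw [energy_gaugeFn hs hφ]; positivity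

theorem shapeScale_sq (hs : IsGauge (gaugeFn N ρ)) (hφ : N.phi (ρ z) ≠ 0) :
    shapeScale N ρ z ^ 2 =
      1 + N.phi (ρ z) ^ 2 * ‖tangGrad (gaugeFn N ρ) (z : Amb n)‖ ^ 2 := by
  rw [shapeScale, mul_pow, Real.sq_sqrt (energy_gaugeFn_pos hs hφ).le, energy_gaugeFn hs hφ]
  field_simp
  ring

theorem shapeScale_pos (hs : IsGauge (gaugeFn N ρ)) (hφ : 0 < N.phi (ρ z)) :
    0 < shapeScale N ρ z :=
  mul_pos hφ (Real.sqrt_pos.2 (energy_gaugeFn_pos hs hφ.ne'))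

theorem fderiv_homExt_eq (h : DifferentiableAt ℝ (homExt ρ) (z : Amb n))
    (hφ : N.phi (ρ z) ≠ 0) (W : Amb n) : fderiv ℝ (homExt ρ) (z : Amb n) W =
      -N.phi (ρ z) ^ 2 * inner ℝ (tangGrad (gaugeFn N ρ) (z : Amb n)) W := by
  rw [tangGrad_gaugeFn h hφ, inner_smul_left, sphGrad, inner_gradient_eq]
  simp only [RCLike.conj_to_real]
  field_simp

variable (hs : IsGauge (gaugeFn N ρ)) (hρ : 0 < ρ z) (hφ : 0 < N.phi (ρ z))
  (h : ContDiffAt ℝ 3 (homExt ρ) (z : Amb n)) (hν : IsOuterUnitNormal N ρ z ν)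

include hs hρ hφ h hν

theorem outerNormal_eq_smul : ν =
    (inner ℝ (z : Amb n) ν : ℝ) • ((z : Amb n) + ρ z • tangGrad (gaugeFn N ρ) (z : Amb n)) := by
  refine ext_inner_left ℝ fun Y => ?_
  have hzz := inner_self_sphere z
  set W : Amb n := Y - (inner ℝ (z : Amb n) Y : ℝ) • (z : Amb n) with hW
  have hW0 : inner ℝ (z : Amb n) W = (0 : ℝ) := by
    rw [hW, inner_sub_right, inner_smul_right, hzz]; ring
  have h1 := hν.inner_tangent N hρ hφ.ne' (h.differentiableAt (by simp)) hW0
  rw [fderiv_homExt_eq (h.differentiableAt (by simp)) hφ.ne', hW, inner_sub_left, inner_sub_right,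
    inner_smul_left, inner_smul_right, real_inner_comm (z : Amb n) (tangGrad _ _),
    hs.inner_self_tangGrad (sphere_norm z), real_inner_comm Y (tangGrad _ _)] at h1
  simp only [RCLike.conj_to_real] at h1
  rw [inner_smul_right, inner_add_right, inner_smul_right, real_inner_comm (z : Amb n) Y]
  field_simp at h1
  linear_combination h1

theorem inner_outerNormal : (inner ℝ (z : Amb n) ν : ℝ) = (shapeScale N ρ z)⁻¹ := by
  have hzz := inner_self_sphere z
  have h0 : 0 < (inner ℝ (z : Amb n) ν : ℝ) := by
    have := hν.outward
    rwa [dRho, dir_radialGraph hρ] at this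
  have h1 := hν.unit
  rw [metricN_radialGraph N hρ] at h1
  set c : ℝ := inner ℝ (z : Amb n) ν with hc
  have h2 : (inner ℝ ν ν : ℝ) =
      c ^ 2 * (1 + ρ z ^ 2 * ‖tangGrad (gaugeFn N ρ) (z : Amb n)‖ ^ 2) := by
    rw [outerNormal_eq_smul hs hρ hφ h hν, ← hc, real_inner_self_eq_norm_sq, norm_smul, mul_pow,
      norm_add_sq_real, inner_smul_right, hs.inner_self_tangGrad (sphere_norm z), sphere_norm,
      norm_smul, Real.norm_eq_abs, Real.norm_eq_abs, mul_pow, sq_abs, sq_abs]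
    ring
  rw [h2] at h1
  have h3 : (c * shapeScale N ρ z) ^ 2 = 1 := by
    rw [mul_pow, shapeScale_sq hs hφ.ne']
    field_simp at h1
    refine mul_left_cancel₀ (pow_pos hρ 2).ne' ?_
    linear_combination h1
  have hw := shapeScale_pos hs hφ
  have h4 : c * shapeScale N ρ z = 1 := by
    nlinarith [mul_pos h0 hw]
  exact eq_inv_of_mul_eq_one_left h4

theorem polarFrame_outerNormal : polarFrame N (radialGraph ρ z) ν =
    (shapeScale N ρ z)⁻¹ •
      ((z : Amb n) + N.phi (ρ z) • tangGrad (gaugeFn N ρ) (z : Amb n)) := by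
  have h1 := outerNormal_eq_smul hs hρ hφ h hν
  rw [polarFrame, dZ, dRho, dir_radialGraph hρ, norm_radialGraph hρ]
  rw [inner_outerNormal hs hρ hφ h hν] at h1 ⊢
  set c := (shapeScale N ρ z)⁻¹
  have h2 : ν - c • (z : Amb n) = (c * ρ z) • tangGrad (gaugeFn N ρ) (z : Amb n) := by
    nth_rewrite 1 [h1]
    module
  rw [h2, smul_smul, smul_smul, smul_add, smul_smul]
  congr 2
  field_simp

theorem supportFn_eq : supportFn N ρ z ν =
    (√(energy N.curv (gaugeFn N ρ) (z : Amb n)))⁻¹ := by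
  rw [supportFn, metricN_radialGraph N hρ, inner_smul_right, inner_self_sphere, inner_smul_left,
    inner_outerNormal hs hρ hφ h hν, shapeScale]
  simp only [RCLike.conj_to_real]
  have := Real.sqrt_pos.2 (energy_gaugeFn_pos hs hφ.ne')
  field_simp
  ring

theorem secondFF_eq_hess {X Y : Amb n} (hX : inner ℝ (z : Amb n) X = 0)
    (hY : inner ℝ (z : Amb n) Y = 0) : secondFF N ρ z ν X Y =
      (shapeScale N ρ z)⁻¹ * N.phi (ρ z) ^ 2 *
        inner ℝ (fderiv ℝ (gradient (gaugeFn N ρ)) (z : Amb n) X) Y := by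
  rw [secondFF_eq N hρ hφ.ne' h hν hX hY, hs.inner_hess (sphere_ne_zero z),
    fderiv_fderiv_gaugeFn h hφ.ne' hX hY, inner_outerNormal hs hρ hφ h hν, SpaceForm.cot]
  field_simp
  ring

omit hν hs in
theorem metricN_pushTangent {X Y : Amb n} (hX : inner ℝ (z : Amb n) X = 0)
    (hY : inner ℝ (z : Amb n) Y = 0) :
    metricN N (radialGraph ρ z) (pushTangent ρ z X) (pushTangent ρ z Y) =
      N.phi (ρ z) ^ 2 * (inner ℝ X Y + N.phi (ρ z) ^ 2 *
        (inner ℝ (tangGrad (gaugeFn N ρ) (z : Amb n)) X *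
          inner ℝ (tangGrad (gaugeFn N ρ) (z : Amb n)) Y)) := by
  have hdiff := h.differentiableAt (by simp)
  rw [metricN_radialGraph N hρ, pushTangent_eq hdiff hX, pushTangent_eq hdiff hY,
    fderiv_homExt_eq hdiff hφ.ne', fderiv_homExt_eq hdiff hφ.ne']
  have hX' : inner ℝ X (z : Amb n) = (0 : ℝ) := by rw [real_inner_comm]; exact hX
  simp only [inner_add_right, inner_smul_right, inner_add_left, inner_smul_left, hX, hY,
    inner_self_sphere, RCLike.conj_to_real, hX']
  field_simp
  ring

/-- The nonzero eigenvalues of the shape operator of the gauge are the principal curvatures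
of the graph, multiplied by `φ √E`. -/
theorem exists_basis_shapeOp {κ : Fin n → ℝ} (hκ : ArePrincipalCurvatures N ρ z ν κ) :
    ∃ b : Module.Basis (Fin (n + 1)) ℝ (Amb n), ∀ i,
      shapeOp N.curv (gaugeFn N ρ) (z : Amb n) (b i) =
        (Fin.cons 0 (fun i => shapeScale N ρ z * κ i) : Fin (n + 1) → ℝ) i • b i := by
  obtain ⟨e, hez, heg, heh⟩ := hκ
  have hzz := inner_self_sphere z
  have hw := shapeScale_pos hs hφ
  set τ := tangGrad (gaugeFn N ρ) (z : Amb n) with hτ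
  have hli : LinearIndependent ℝ (Fin.cons (z : Amb n) e : Fin (n + 1) → Amb n) := by
    rw [Fintype.linearIndependent_iff]
    intro g hg
    rw [Fin.sum_univ_succ] at hg
    simp only [Fin.cons_zero, Fin.cons_succ] at hg
    have hg0 : g 0 = 0 := by
      have := congrArg (fun y => (inner ℝ (z : Amb n) y : ℝ)) hg
      simpa only [inner_add_right, inner_smul_right, inner_sum, hez, hzz, mul_one, mul_zero,
        Finset.sum_const_zero, add_zero, inner_zero_right] using this
    rw [hg0, zero_smul, zero_add] at hg
    intro i
    refine Fin.cases hg0 (fun i => ?_) i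
    have h1 := congrArg (fun y => (N.phi (ρ z) ^ 2 * (inner ℝ (e i) y + N.phi (ρ z) ^ 2 *
        (inner ℝ τ (e i) * inner ℝ τ y)) : ℝ)) hg
    simp only [inner_sum, inner_smul_right, inner_zero_right, mul_zero, add_zero,
      Finset.mul_sum] at h1
    rw [← Finset.sum_add_distrib, Finset.mul_sum] at h1
    have h2 : ∀ j, N.phi (ρ z) ^ 2 * (g j.succ * inner ℝ (e i) (e j) + N.phi (ρ z) ^ 2 *
        (inner ℝ τ (e i) * (g j.succ * inner ℝ τ (e j)))) =
        g j.succ * (if i = j then 1 else 0 : ℝ) := fun j => by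
      rw [← heg i j, metricN_pushTangent hρ hφ h (hez i) (hez j)]
      ring
    simpa only [h2, mul_ite, mul_one, mul_zero, Finset.sum_ite_eq, Finset.mem_univ, if_true] using h1
  let b := basisOfLinearIndependentOfCardEqFinrank hli (by simp)
  have hb : ∀ i, b i = (Fin.cons (z : Amb n) e : Fin (n + 1) → Amb n) i := fun i => by simp [b]
  have hHe : ∀ i, fderiv ℝ (gradient (gaugeFn N ρ)) (z : Amb n) (e i) =
      (shapeScale N ρ z * κ i) • (e i + (N.phi (ρ z) ^ 2 * inner ℝ τ (e i)) • τ) := by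
    intro i
    refine InnerProductSpace.ext_inner_right_basis b fun j => ?_
    rw [hb]
    refine Fin.cases ?_ (fun j => ?_) j
    · rw [Fin.cons_zero, real_inner_comm, hs.inner_hess_self (sphere_ne_zero z), real_inner_comm,
        inner_smul_right, inner_add_right, hez, inner_smul_right,
        hs.inner_self_tangGrad (sphere_norm z)]
      ring
    · rw [Fin.cons_succ]
      have h1 := heh i j
      have h2 := heg i j
      rw [secondFF_eq_hess hs hρ hφ h hν (hez i) (hez j)] at h1
      rw [metricN_pushTangent hρ hφ h (hez i) (hez j)] at h2
      rw [inner_smul_left, inner_add_left, inner_smul_left]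
      simp only [RCLike.conj_to_real]
      have h3 : (if i = j then κ i else 0) = κ i * (if i = j then 1 else 0) := by
        split_ifs <;> simp
      rw [h3, ← h2] at h1
      field_simp at h1
      linear_combination h1
  refine ⟨b, fun i => ?_⟩
  rw [hb]
  refine Fin.cases ?_ (fun i => ?_) i
  · simp [shapeOp_apply, hs.hess_self (sphere_ne_zero z)]
  · rw [Fin.cons_succ, Fin.cons_succ, shapeOp_apply, hHe, ← hτ, inner_smul_right, inner_add_right,
      inner_smul_right, real_inner_self_eq_norm_sq, smul_add, add_sub_assoc, add_eq_left, smul_smul,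
      ← sub_smul]
    have hE := energy_gaugeFn_pos hs hφ.ne'
    have hE' := energy_gaugeFn (z := z) hs hφ.ne'
    rw [← hτ] at hE'
    have : shapeScale N ρ z * κ i * (N.phi (ρ z) ^ 2 * inner ℝ τ (e i)) -
        (energy N.curv (gaugeFn N ρ) (z : Amb n))⁻¹ * (shapeScale N ρ z * κ i * (inner ℝ τ (e i) +
          N.phi (ρ z) ^ 2 * inner ℝ τ (e i) * ‖τ‖ ^ 2)) = 0 := by
      field_simp
      rw [hE']
      field_simp
      ring
    rw [this, zero_smul]

theorem elemPoly_shapeOp_coeff {κ : Fin n → ℝ} (hκ : ArePrincipalCurvatures N ρ z ν κ) (j : ℕ) :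
    (elemPoly (shapeOp N.curv (gaugeFn N ρ) (z : Amb n))).coeff j =
      shapeScale N ρ z ^ j * (genPoly Finset.univ κ).coeff j := by
  obtain ⟨b, hb⟩ := exists_basis_shapeOp hs hρ hφ h hν hκ
  rw [elemPoly_eq_genPoly b hb, genPoly_cons_zero, genPoly_smul_coeff]

end GraphGeometry

/-! ### First and second order conditions at a maximum -/

/-- The second derivative test, as a necessary condition. -/
theorem IsLocalMax.second_deriv_nonpos {f g : ℝ → ℝ} {x c : ℝ} (hf : IsLocalMax f x)
    (hfg : ∀ᶠ t in nhds x, HasDerivAt f (g t) t) (hg : HasDerivAt g c x) : c ≤ 0 := by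
  by_contra hc
  push Not at hc
  have h1 : deriv f =ᶠ[nhds x] g := hfg.mono fun t ht => ht.deriv
  have h2 : deriv (deriv f) x = c := by rw [h1.deriv_eq, hg.deriv]
  have h3 : deriv f x = 0 := hf.deriv_eq_zero
  have h4 := isLocalMin_of_deriv_deriv_pos (by rw [h2]; exact hc) h3
    hfg.self_of_nhds.continuousAt
  have h5 : f =ᶠ[nhds x] fun _ => f x := by
    filter_upwards [hf, h4] with t h6 h7 using le_antisymm h6 h7
  have h6 : deriv f =ᶠ[nhds x] fun _ => 0 := by
    filter_upwards [h5.eventuallyEq_nhds] with t ht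
    rw [ht.deriv_eq, deriv_const]
  have h7 : deriv (deriv f) x = 0 := by rw [h6.deriv_eq, deriv_const]
  rw [h2] at h7
  exact hc.ne' h7

section Eigenbasis

variable {V : Type*} [NormedAddCommGroup V] [InnerProductSpace ℝ V] [FiniteDimensional ℝ V]

/-- Two orthonormal eigenvectors of a symmetric map are part of an orthonormal eigenbasis. -/
theorem LinearMap.IsSymmetric.exists_eigenbasis_extending {T : V →ₗ[ℝ] V} (hT : T.IsSymmetric)
    {z e : V} (hz : ‖z‖ = 1) (he : ‖e‖ = 1) (hze : inner ℝ z e = (0 : ℝ)) {a c : ℝ}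
    (hTz : T z = a • z) (hTe : T e = c • e) :
    ∃ (m : ℕ) (b : OrthonormalBasis (Option (Option (Fin m))) ℝ V)
      (l : Option (Option (Fin m)) → ℝ), b none = z ∧ b (some none) = e ∧
        ∀ i, T (b i) = l i • b i := by
  set W : Submodule ℝ V := (Submodule.span ℝ {z, e})ᗮ with hW
  have hmem : ∀ x, x ∈ W ↔ inner ℝ z x = (0 : ℝ) ∧ inner ℝ e x = (0 : ℝ) := by
    intro x
    rw [hW, Submodule.mem_orthogonal]
    constructor
    · intro h
      exact ⟨h z (Submodule.subset_span (by simp)), h e (Submodule.subset_span (by simp))⟩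
    · rintro ⟨h1, h2⟩ u hu
      obtain ⟨p, q, rfl⟩ := Submodule.mem_span_pair.1 hu
      simp [inner_add_left, inner_smul_left, h1, h2]
  have hinv : ∀ x ∈ W, T x ∈ W := by
    intro x hx
    rw [hmem] at hx ⊢
    rw [← hT, ← hT, hTz, hTe, inner_smul_left, inner_smul_left, hx.1, hx.2]
    simp
  have hTW : (T.restrict hinv).IsSymmetric := hT.restrict_invariant hinv
  let w := hTW.eigenvectorBasis rfl
  have hw : ∀ i, inner ℝ z (w i : V) = (0 : ℝ) ∧ inner ℝ e (w i : V) = (0 : ℝ) :=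
    fun i => (hmem _).1 (w i).2
  let f : Option (Option (Fin (Module.finrank ℝ W))) → V := fun i =>
    i.elim z fun j => j.elim e fun k => (w k : V)
  have hwo : ∀ i j, (inner ℝ (w i : V) (w j : V) : ℝ) = if i = j then 1 else 0 := by
    intro i j
    rw [← Submodule.coe_inner, OrthonormalBasis.inner_eq_ite]
  have hon : Orthonormal ℝ f := by
    rw [orthonormal_iff_ite]
    rintro (_ | _ | i) (_ | _ | j)
    · simp [f, hz]
    · simp [f, hze]
    · simp [f, (hw j).1]
    · simp [f, real_inner_comm, hze]
    · simp [f, he]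
    · simp [f, (hw j).2]
    · simpa [f, real_inner_comm] using (hw i).1
    · simpa [f, real_inner_comm] using (hw i).2
    · simp [f, hwo]
  have hsp : (Submodule.span ℝ (Set.range f))ᗮ = ⊥ := by
    rw [eq_bot_iff]
    intro x hx
    rw [Submodule.mem_orthogonal] at hx
    have hx' : ∀ i, inner ℝ (f i) x = (0 : ℝ) :=
      fun i => hx _ (Submodule.subset_span ⟨i, rfl⟩)
    have hxW : x ∈ W := (hmem x).2 ⟨hx' none, hx' (some none)⟩
    have h0 : (⟨x, hxW⟩ : W) = 0 := by
      refine InnerProductSpace.ext_inner_left_basis w.toBasis fun i => ?_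
      rw [OrthonormalBasis.coe_toBasis, inner_zero_right, Submodule.coe_inner]
      exact hx' (some (some i))
    simpa using congrArg Subtype.val h0
  let b := OrthonormalBasis.mkOfOrthogonalEqBot hon hsp
  have hb : ∀ i, b i = f i := fun i => by simp [b]
  refine ⟨_, b, fun i => i.elim a fun j => j.elim c fun k => hTW.eigenvalues rfl k,
    hb _, hb _, ?_⟩
  rintro (_ | _ | i)
  · rw [hb]; exact hTz
  · rw [hb]; exact hTe
  · rw [hb]
    have := congrArg Subtype.val (hTW.apply_eigenvectorBasis rfl i)
    exact this

end Eigenbasis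

namespace IsGauge

variable {V : Type*} [NormedAddCommGroup V] [InnerProductSpace ℝ V] [FiniteDimensional ℝ V]
  {s : V → ℝ} (hs : IsGauge s) {K α : ℝ} {z : V}

/-- The test function `log √E + α v` of the maximum principle, where `v` is the restriction of the
gauge to the unit sphere. -/
noncomputable def testFn (K α : ℝ) (s : V → ℝ) (x : V) : ℝ :=
  Real.log (energy K s x) / 2 + α * (s x / ‖x‖)

include hs

omit hs [FiniteDimensional ℝ V] [InnerProductSpace ℝ V] in
theorem ne_zero_of_norm_one (hz : ‖z‖ = 1) : z ≠ 0 :=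
  norm_ne_zero_iff.1 (by rw [hz]; exact one_ne_zero)

theorem hasFDerivAt_energy {x : V} (hx : x ≠ 0) : HasFDerivAt (energy K s)
    (2 • (innerSL ℝ (gradient s x)) ∘L fderiv ℝ (gradient s) x) x := by
  have := ((hs.differentiableAt_gradient hx).hasFDerivAt.norm_sq).add_const K
  exact this

omit hs [FiniteDimensional ℝ V] in
theorem hasFDerivAt_norm_inv {x : V} (hx : x ≠ 0) :
    HasFDerivAt (fun y : V => ‖y‖⁻¹) (-(‖x‖ ^ 3)⁻¹ • innerSL ℝ x) x := by
  have h := (hasStrictFDerivAt_norm_sq x).hasFDerivAt.sqrt (by positivity)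
  simp only [Real.sqrt_sq (norm_nonneg _)] at h
  have h1 := (hasDerivAt_inv (norm_ne_zero_iff.2 hx)).comp_hasFDerivAt x h
  refine h1.congr_fderiv ?_
  have hx' : ‖x‖ ≠ 0 := norm_ne_zero_iff.2 hx
  ext v
  simp only [smul_apply, innerSL_apply_apply, smul_eq_mul, nsmul_eq_mul]
  field_simp
  simp

theorem hasFDerivAt_testFn {x : V} (hx : x ≠ 0) (hE : energy K s x ≠ 0) :
    HasFDerivAt (testFn K α s)
      ((energy K s x)⁻¹ • (innerSL ℝ (gradient s x)) ∘L fderiv ℝ (gradient s) x +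
        α • (‖x‖⁻¹ • innerSL ℝ (gradient s x) - (s x * (‖x‖ ^ 3)⁻¹) • innerSL ℝ x)) x := by
  have h1 := ((hs.hasFDerivAt_energy (K := K) hx).log hE).mul_const (2⁻¹ : ℝ)
  have h2 := ((((hs.contDiffAt x hx).differentiableAt (by simp)).hasFDerivAt.mul
    (hasFDerivAt_norm_inv hx))).const_mul α
  have h3 := h1.add h2
  refine (h3.congr_fderiv ?_).congr_of_eventuallyEq (Filter.Eventually.of_forall fun y => ?_)
  · ext v
    simp only [add_apply, smul_apply, sub_apply, ContinuousLinearMap.comp_apply,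
      innerSL_apply_apply, smul_eq_mul, nsmul_eq_mul, inner_gradient_eq]
    push_cast
    ring
  · simp only [testFn, Pi.add_apply, Pi.mul_apply, div_eq_mul_inv]

/-- At a critical point of the test function, the spherical gradient of the gauge is an
eigenvector of the Hessian, with negative eigenvalue `-α E`. -/
theorem hess_tangGrad (hz : ‖z‖ = 1) (hE : energy K s z ≠ 0)
    (hmax : IsLocalMax (testFn K α s) z) :
    fderiv ℝ (gradient s) z (tangGrad s z) = (-(α * energy K s z)) • tangGrad s z := by
  have h0 := ne_zero_of_norm_one hz
  have h1 := hmax.hasFDerivAt_eq_zero (hs.hasFDerivAt_testFn h0 hE)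
  refine ext_inner_right ℝ fun X => ?_
  have h2 := congrArg (fun L : V →L[ℝ] ℝ => L X) h1
  simp only [add_apply, smul_apply, sub_apply, ContinuousLinearMap.comp_apply,
    innerSL_apply_apply, smul_eq_mul, hz, zero_apply] at h2
  have h3 : fderiv ℝ (gradient s) z (tangGrad s z) = fderiv ℝ (gradient s) z (gradient s z) := by
    rw [tangGrad, map_sub, map_smul, hs.hess_self h0, smul_zero, sub_zero]
  rw [h3, hs.inner_hess_symm h0, real_inner_comm, inner_smul_left, tangGrad, inner_sub_left,
    inner_smul_left]
  simp only [RCLike.conj_to_real]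
  field_simp at h2
  linear_combination h2

theorem second_order (hz : ‖z‖ = 1) (hE : energy K s z ≠ 0)
    (hmax : IsLocalMax (testFn K α s) z) {X : V} (hX : inner ℝ z X = (0 : ℝ)) :
    (‖fderiv ℝ (gradient s) z X‖ ^ 2 +
        inner ℝ (fderiv ℝ (fderiv ℝ (gradient s)) z (tangGrad s z) X) X -
        s z * inner ℝ (fderiv ℝ (gradient s) z X) X) / energy K s z
      - 2 * (inner ℝ (tangGrad s z) (fderiv ℝ (gradient s) z X) / energy K s z) ^ 2
      + α * (inner ℝ (fderiv ℝ (gradient s) z X) X - s z * ‖X‖ ^ 2) ≤ 0 := by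
  have h0 := ne_zero_of_norm_one hz
  have hz0 : z + (0 : ℝ) • X = z := by simp
  have hc : ContinuousAt (fun t : ℝ => z + t • X) 0 := (hasDerivAt_line z X 0).continuousAt
  have hmax' : IsLocalMax (fun t : ℝ => testFn K α s (z + t • X)) 0 := by
    have hm : IsLocalMax (testFn K α s) (z + (0 : ℝ) • X) := by rwa [hz0]
    exact hc.tendsto.eventually hm
  have hEev : ∀ᶠ t in nhds (0 : ℝ), energy K s (z + t • X) ≠ 0 := by
    have h1 : ContinuousAt (energy K s) (z + (0 : ℝ) • X) := by
      rw [hz0]; exact (hs.hasFDerivAt_energy h0).continuousAt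
    have h2 : ContinuousAt (fun t : ℝ => energy K s (z + t • X)) 0 :=
      ContinuousAt.comp (f := fun t : ℝ => z + t • X) h1 hc
    exact h2.eventually_ne (by rwa [hz0])
  have hfg : ∀ᶠ t in nhds (0 : ℝ), HasDerivAt (fun t : ℝ => testFn K α s (z + t • X))
      ((energy K s (z + t • X))⁻¹ *
          inner ℝ (gradient s (z + t • X)) (fderiv ℝ (gradient s) (z + t • X) X) +
        α * (‖z + t • X‖⁻¹ * inner ℝ (gradient s (z + t • X)) X -
          s (z + t • X) * ‖z + t • X‖⁻¹ ^ 3 * inner ℝ (z + t • X) X)) t := by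
    filter_upwards [eventually_line_ne h0 X, hEev] with t ht htE
    refine ((hs.hasFDerivAt_testFn ht htE).comp_hasDerivAt t
      (hasDerivAt_line z X t)).congr_deriv ?_
    simp only [add_apply, smul_apply, sub_apply, ContinuousLinearMap.comp_apply,
      innerSL_apply_apply, smul_eq_mul, inv_pow]
  -- the derivative of the first derivative at `0`
  have hp := (hs.differentiableAt_gradient h0).hasDerivAt_line X
  have hH := hs.hasDerivAt_hess_line h0 X X
  have hEd := (hs.hasFDerivAt_energy (K := K) h0).hasDerivAt_line X
  have hn := (hasFDerivAt_norm_inv h0).hasDerivAt_line X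
  have hsd := ((hs.contDiffAt z h0).differentiableAt (by simp)).hasDerivAt_line X
  have hin := (hasDerivAt_line z X 0).inner ℝ (hasDerivAt_const (0 : ℝ) X)
  have hpX := hp.inner ℝ (hasDerivAt_const (0 : ℝ) X)
  have hg := ((hEd.inv (by rwa [hz0])).mul (hp.inner ℝ hH)).add
    (((hn.mul hpX).sub ((hsd.mul (hn.pow 3)).mul hin)).const_mul α)
  have hfin := hmax'.second_deriv_nonpos hfg hg
  simp only [Pi.inv_apply, Pi.mul_apply, Pi.pow_apply, hz0, hz, smul_apply,
    ContinuousLinearMap.comp_apply, innerSL_apply_apply, hX, smul_eq_mul, inner_zero_right,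
    nsmul_eq_mul, real_inner_self_eq_norm_sq] at hfin
  have e1 : (inner ℝ (gradient s z) (fderiv ℝ (gradient s) z X) : ℝ) =
      inner ℝ (tangGrad s z) (fderiv ℝ (gradient s) z X) := by
    rw [tangGrad, inner_sub_left, inner_smul_left, hs.inner_hess_self h0, mul_zero, sub_zero]
  have e2 : (inner ℝ (gradient s z) (fderiv ℝ (fderiv ℝ (gradient s)) z X X) : ℝ) =
      inner ℝ (fderiv ℝ (fderiv ℝ (gradient s)) z (tangGrad s z) X) X -
        s z * inner ℝ (fderiv ℝ (gradient s) z X) X := by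
    have : (inner ℝ (fderiv ℝ (fderiv ℝ (gradient s)) z X X) z : ℝ) =
        -inner ℝ (fderiv ℝ (gradient s) z X) X := by
      rw [hs.inner_third_symm h0, hs.third_self h0, inner_neg_left]
    rw [hs.third_symm h0 (tangGrad s z) X, real_inner_comm,
      hs.inner_third_symm h0 X (tangGrad s z) X, tangGrad, inner_sub_right, inner_smul_right, this]
    ring
  rw [e1, e2] at hfin
  push_cast at hfin
  refine le_trans (le_of_eq ?_) hfin
  field_simp
  ring

end IsGauge

/-! ### The linearized equation at a maximum of the test function -/

namespace IsGauge

variable {V : Type*} [NormedAddCommGroup V] [InnerProductSpace ℝ V] [FiniteDimensional ℝ V]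
  {s : V → ℝ} (hs : IsGauge s) {K α : ℝ} {z : V} {γ : ℝ → V}

include hs

theorem hasDerivAt_energy_curve (hz : z ≠ 0) {X : V} (hγ0 : γ 0 = z) (hγ : HasDerivAt γ X 0) :
    HasDerivAt (fun t => energy K s (γ t))
      (2 * inner ℝ (gradient s z) (fderiv ℝ (gradient s) z X)) 0 := by
  subst hγ0
  refine ((hs.hasFDerivAt_energy (K := K) hz).comp_hasDerivAt 0 hγ).congr_deriv ?_
  simp

theorem hasDerivAt_tangGrad_curve (hz : z ≠ 0) {X : V} (hγ0 : γ 0 = z) (hγ : HasDerivAt γ X 0) :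
    HasDerivAt (fun t => tangGrad s (γ t))
      (fderiv ℝ (gradient s) z X - (s z • X + (inner ℝ (gradient s z) X : ℝ) • z)) 0 := by
  subst hγ0
  rw [inner_gradient_eq]
  exact ((hs.differentiableAt_gradient hz).hasFDerivAt.comp_hasDerivAt 0 hγ).sub
    ((((hs.contDiffAt _ hz).differentiableAt (by simp)).hasFDerivAt.comp_hasDerivAt 0 hγ).smul hγ)

theorem hasDerivAt_hess_curve (hz : z ≠ 0) {X : V} (hγ0 : γ 0 = z) (hγ : HasDerivAt γ X 0) :
    HasDerivAt (fun t => fderiv ℝ (gradient s) (γ t))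
      (fderiv ℝ (fderiv ℝ (gradient s)) z X) 0 := by
  subst hγ0
  exact (hs.differentiableAt_hess hz).hasFDerivAt.comp_hasDerivAt 0 hγ

theorem differentiableAt_shapeOp {x : V} (hx : x ≠ 0) (hE : energy K s x ≠ 0) :
    DifferentiableAt ℝ (shapeOp K s) x := by
  have hτ : DifferentiableAt ℝ (tangGrad s) x :=
    (hs.differentiableAt_gradient hx).sub
      (((hs.contDiffAt x hx).differentiableAt (by simp)).smul differentiableAt_id)
  have hEi : DifferentiableAt ℝ (fun y => (energy K s y)⁻¹) x :=
    (hs.hasFDerivAt_energy hx).differentiableAt.inv hE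
  have hL : DifferentiableAt ℝ (fun y => innerSL ℝ (tangGrad s y)) x :=
    (innerSL ℝ).differentiableAt.comp x hτ
  have hR : DifferentiableAt ℝ
      (fun y => (innerSL ℝ (tangGrad s y)).smulRight (tangGrad s y)) x := by
    have h := ((ContinuousLinearMap.smulRightL ℝ V V).isBoundedBilinearMap.differentiableAt
      (innerSL ℝ (tangGrad s x), tangGrad s x)).comp x (hL.prodMk hτ)
    exact h
  exact ((differentiableAt_const _).sub (hEi.smul hR)).clm_comp (hs.differentiableAt_hess hx)

/-- The derivative of the entries of the shape operator along a curve. -/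
theorem hasDerivAt_inner_shapeOp (hz : z ≠ 0) (hE : energy K s z ≠ 0) {X : V} (hγ0 : γ 0 = z)
    (hγ : HasDerivAt γ X 0) (b : V) {τ' : V} {E' : ℝ}
    (hτ' : HasDerivAt (fun t => tangGrad s (γ t)) τ' 0)
    (hE' : HasDerivAt (fun t => energy K s (γ t)) E' 0) :
    HasDerivAt (fun t => inner ℝ b (shapeOp K s (γ t) b))
      (inner ℝ b (fderiv ℝ (fderiv ℝ (gradient s)) z X b) -
        ((-E' / energy K s z ^ 2 * inner ℝ (tangGrad s z) (fderiv ℝ (gradient s) z b) +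
          (energy K s z)⁻¹ * (inner ℝ (tangGrad s z) (fderiv ℝ (fderiv ℝ (gradient s)) z X b) +
            inner ℝ τ' (fderiv ℝ (gradient s) z b))) * inner ℝ (tangGrad s z) b +
        ((energy K s z)⁻¹ * inner ℝ (tangGrad s z) (fderiv ℝ (gradient s) z b)) *
          inner ℝ τ' b)) 0 := by
  have hH := (hs.hasDerivAt_hess_curve hz hγ0 hγ).clm_apply (hasDerivAt_const (0 : ℝ) b)
  have hb := hasDerivAt_const (0 : ℝ) b
  have h := (hb.inner ℝ hH).sub
    (((hE'.inv (by rwa [hγ0])).mul (hτ'.inner ℝ hH)).mul (hτ'.inner ℝ hb))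
  refine (h.congr_of_eventuallyEq (Filter.Eventually.of_forall fun t => ?_)).congr_deriv ?_
  · simp only [shapeOp_apply, inner_sub_right, inner_smul_right, Pi.sub_apply, Pi.mul_apply,
      Pi.inv_apply, real_inner_comm b (tangGrad s (γ t))]
  · simp only [hγ0, Pi.mul_apply, Pi.inv_apply, map_zero, add_zero, inner_zero_left,
      inner_zero_right, zero_add]

/-- The maximum principle inequality. At a maximum `z` of `log √E + α v`, the derivative `D` of
`σ_{m+1}` of the shape operator in the direction of the spherical gradient `τ` is bounded above,
with a negative term quadratic in `α`. Here `S₁` is the derivative of `σ_{m+1}` with respect to the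
eigenvalue of the eigenvector `τ`. This eigenvalue is negative, so `S₁` dominates `σ_m`. -/
theorem exists_deriv_elemPoly_le (hz : ‖z‖ = 1) (hE : 0 < energy K s z) (hα : 0 < α)
    (hsz : 0 < s z) (hK : 0 < s z ^ 2 + K) (hmax : IsLocalMax (testFn K α s) z)
    (hτ : tangGrad s z ≠ 0) (hγ0 : γ 0 = z) (hγ : HasDerivAt γ (tangGrad s z) 0) (m : ℕ)
    (hpos : ∀ j ≤ m + 1, 0 < (elemPoly (shapeOp K s z)).coeff j) :
    ∃ D S₁ : ℝ, HasDerivAt (fun t => (elemPoly (shapeOp K s (γ t))).coeff (m + 1)) D 0 ∧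
      (elemPoly (shapeOp K s z)).coeff m ≤ S₁ ∧
      D + S₁ * energy K s z * (α ^ 2 * (s z ^ 2 + K) - α * s z * Module.finrank ℝ V) ≤
        (s z - α * energy K s z) * ((m + 1) * (elemPoly (shapeOp K s z)).coeff (m + 1)) := by
  classical
  have h0 := ne_zero_of_norm_one hz
  set τ := tangGrad s z with hτdef
  set E := energy K s z with hEdef
  set v := s z with hv
  set H := fderiv ℝ (gradient s) z with hH
  have hzτ : inner ℝ z τ = (0 : ℝ) := hs.inner_self_tangGrad hz
  have hτn : 0 < ‖τ‖ := norm_pos_iff.2 hτ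
  have hEeq : E = ‖τ‖ ^ 2 + (v ^ 2 + K) := hs.energy_eq K hz
  have hHτ : H τ = (-(α * E)) • τ := hs.hess_tangGrad hz hE.ne' hmax
  -- an eigenbasis of the Hessian which contains `z` and the direction of `τ`
  set e : V := ‖τ‖⁻¹ • τ with he
  have hen : ‖e‖ = 1 := by rw [he, norm_smul, norm_inv, norm_norm, inv_mul_cancel₀ hτn.ne']
  have hτe : τ = ‖τ‖ • e := by rw [he, smul_smul, mul_inv_cancel₀ hτn.ne', one_smul]
  have hze : inner ℝ z e = (0 : ℝ) := by rw [he, inner_smul_right, hzτ, mul_zero]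
  have hHsymm : (H : V →ₗ[ℝ] V).IsSymmetric := fun x y =>
    (hs.inner_hess_symm h0 x y).trans (real_inner_comm x (H y))
  obtain ⟨q, b, l, hbz, hbe, hbl⟩ := hHsymm.exists_eigenbasis_extending hz hen hze
    (a := 0) (c := -(α * E)) (by simpa using hs.hess_self h0)
    (by rw [he, map_smul]
        exact (congrArg _ hHτ).trans (smul_comm _ _ _))
  have hbl' : ∀ i, H (b i) = l i • b i := hbl
  have hlz : l none = 0 := by
    have h1 := hbl' none
    rw [hbz, hs.hess_self h0] at h1
    exact (smul_eq_zero.1 h1.symm).resolve_right h0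
  have hle : l (some none) = -(α * E) := by
    have h1 := hbl' (some none)
    rw [hbe, he, map_smul, hHτ, smul_comm, ← sub_eq_zero, ← sub_smul] at h1
    have h2 := (smul_eq_zero.1 h1).resolve_right (norm_ne_zero_iff.1 (by rw [hen]; exact one_ne_zero))
    linarith
  have hτb : ∀ i, (inner ℝ τ (b i) : ℝ) = if i = some none then ‖τ‖ else 0 := by
    intro i
    rw [hτe, ← hbe, inner_smul_left, OrthonormalBasis.inner_eq_ite]
    simp [norm_smul, eq_comm]
  have hzb : ∀ i, i ≠ none → inner ℝ z (b i) = (0 : ℝ) := by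
    intro i hi
    rw [← hbz, OrthonormalBasis.inner_eq_ite, if_neg hi.symm]
  -- `a i` are the eigenvalues of `1 - E⁻¹ τ ⊗ τ`
  set a : Option (Option (Fin q)) → ℝ := fun i => if i = some none then 1 - ‖τ‖ ^ 2 / E else 1
    with ha
  have haE : (1 - ‖τ‖ ^ 2 / E) * E = v ^ 2 + K := by
    rw [sub_mul, div_mul_cancel₀ _ hE.ne', hEeq]; ring
  have ha1 : 0 < 1 - ‖τ‖ ^ 2 / E := by
    by_contra hcon
    push Not at hcon
    nlinarith
  have ha1' : 1 - ‖τ‖ ^ 2 / E ≤ 1 := by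
    have : 0 ≤ ‖τ‖ ^ 2 / E := by positivity
    linarith
  set μ : Option (Option (Fin q)) → ℝ := fun i => a i * l i with hμ
  have hT : ∀ i, shapeOp K s z (b i) = μ i • b i := by
    intro i
    rw [shapeOp_apply, ← hH, ← hτdef, ← hEdef, hbl', inner_smul_right, hτb]
    by_cases hi : i = some none
    · subst hi
      simp only [if_true, hμ, ha]
      have h1 : (E⁻¹ * (l (some none) * ‖τ‖)) • τ =
          (E⁻¹ * (l (some none) * ‖τ‖) * ‖τ‖) • b (some none) := by
        calc _ = (E⁻¹ * (l (some none) * ‖τ‖)) • (‖τ‖ • e) := by rw [← hτe]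
          _ = _ := by rw [smul_smul, hbe]
      rw [h1, ← sub_smul]
      congr 1
      ring
    · simp [hi, hμ, ha]
  have hpoly : elemPoly (shapeOp K s z) = genPoly Finset.univ μ :=
    elemPoly_eq_genPoly b.toBasis fun i => by rw [OrthonormalBasis.coe_toBasis]; exact hT i
  rw [hpoly] at hpos ⊢
  set S : Option (Option (Fin q)) → ℝ := fun i => (genPoly (Finset.univ.erase i) μ).coeff m with hS
  have hSpos : ∀ i, 0 < S i := fun i =>
    genPoly_erase_coeff_pos _ μ (Finset.mem_univ i) hpos m le_rfl
  have hμe : μ (some none) < 0 := by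
    simp only [hμ, ha, if_true, hle]
    have := mul_pos ha1 (mul_pos hα hE)
    linarith
  have hS1 : (genPoly Finset.univ μ).coeff m ≤ S (some none) :=
    genPoly_coeff_le_erase _ μ (Finset.mem_univ _) hμe.le hpos
  -- the derivative of the equation in the direction `τ`
  set T : Option (Option (Fin q)) → ℝ :=
    fun i => inner ℝ (fderiv ℝ (fderiv ℝ (gradient s)) z τ (b i)) (b i) with hTdef
  have hpτ : (inner ℝ (gradient s z) τ : ℝ) = ‖τ‖ ^ 2 := hs.inner_gradient_tangGrad hz
  have hτ' := hs.hasDerivAt_tangGrad_curve h0 hγ0 hγ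
  have hE' := hs.hasDerivAt_energy_curve (K := K) h0 hγ0 hγ
  rw [← hH, hHτ, hpτ, ← hv] at hτ'
  rw [← hH, hHτ, inner_smul_right, hpτ] at hE'
  set T' : Option (Option (Fin q)) → ℝ := fun i =>
    i.elim 0 fun j => j.elim
      ((1 - ‖τ‖ ^ 2 / E) * T (some none) - 2 * α ^ 2 * E * ‖τ‖ ^ 2 * (1 - ‖τ‖ ^ 2 / E) -
        2 * α * v * ‖τ‖ ^ 2) fun k => T (some (some k)) with hT'
  have hderiv : ∀ i, HasDerivAt (fun t => inner ℝ (b i) (shapeOp K s (γ t) (b i))) (T' i) 0 := by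
    intro i
    have h1 := hs.hasDerivAt_inner_shapeOp h0 hE.ne' hγ0 hγ (b i) hτ' hE'
    rw [← hτdef, ← hH, ← hEdef, hbl', inner_smul_right, hτb] at h1
    refine h1.congr_deriv ?_
    match i with
    | none =>
      have h2 : (inner ℝ z (fderiv ℝ (fderiv ℝ (gradient s)) z τ z) : ℝ) = 0 := by
        rw [hs.third_self h0, inner_neg_right, hs.inner_hess_self h0, neg_zero]
      simp [hT', hbz, h2, hlz]
    | some none =>
      have h2 : (inner ℝ (τ : V) (fderiv ℝ (fderiv ℝ (gradient s)) z τ (b (some none))) : ℝ) =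
          ‖τ‖ * T (some none) := by
        rw [hTdef]
        nth_rewrite 1 [hτe]
        rw [inner_smul_left, ← hbe, real_inner_comm]
        rfl
      have h3 : (inner ℝ (b (some none)) (fderiv ℝ (fderiv ℝ (gradient s)) z τ (b (some none))) : ℝ)
          = T (some none) := real_inner_comm _ _
      simp only [if_true, hle, hT', Option.elim, h2, h3, inner_sub_left, inner_add_left,
        inner_smul_left, inner_smul_right, hτb, hzb (some none) (by simp), RCLike.conj_to_real]
      field_simp
      ring
    | some (some k) =>
      simp [hT', hTdef, real_inner_comm]
  have hTdiff : DifferentiableAt ℝ (fun t => shapeOp K s (γ t)) 0 := by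
    have h1 : DifferentiableAt ℝ (shapeOp K s) (γ 0) := by
      rw [hγ0]; exact hs.differentiableAt_shapeOp h0 hE.ne'
    exact h1.comp 0 hγ.differentiableAt
  have hD := hasDerivAt_elemPoly_coeff b (T := fun t => shapeOp K s (γ t)) (x := 0) (μ := μ)
    (fun i => by rw [hγ0]; exact hT i) hTdiff hderiv m
  refine ⟨_, S (some none), hD, hS1, ?_⟩
  -- the second order condition in the directions `b i`, weighted with `S i * a i`
  have hsecond : ∀ i, i ≠ none → T i ≤ v * l i - l i ^ 2 + (if i = some none then
      2 * α ^ 2 * E * ‖τ‖ ^ 2 else 0) - α * E * l i + α * E * v := by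
    intro i hi
    have h1 := hs.second_order hz hE.ne' hmax (hzb i hi)
    rw [← hH, ← hτdef, ← hEdef, ← hv, hbl', norm_smul, mul_pow, b.norm_eq_one, inner_smul_right,
      inner_smul_left, real_inner_self_eq_norm_sq, b.norm_eq_one, hτb, Real.norm_eq_abs,
      sq_abs] at h1
    simp only [RCLike.conj_to_real, one_pow, mul_one] at h1
    have h2 : (inner ℝ (fderiv ℝ (fderiv ℝ (gradient s)) z τ (b i)) (b i) : ℝ) = T i := rfl
    rw [h2] at h1
    have h3 : (l i * (if i = some none then ‖τ‖ else 0) / E) ^ 2 =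
        if i = some none then α ^ 2 * ‖τ‖ ^ 2 else 0 := by
      split_ifs with hi'
      · rw [hi', hle]; field_simp
      · simp
    rw [h3] at h1
    have h4 : (l i ^ 2 + T i - v * l i) ≤
        E * (2 * (if i = some none then α ^ 2 * ‖τ‖ ^ 2 else 0) - α * (l i - v)) := by
      rw [← div_le_iff₀' hE]; linarith
    split_ifs at h4 ⊢ <;> linarith
  have hterm : ∀ i, T' i * S i + (if i = some none then S i * (E * α ^ 2 * (v ^ 2 + K)) else 0) ≤
      (v - α * E) * (μ i * S i) + α * E * v * S i := by
    intro i
    have hSi := hSpos i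
    match i with
    | none =>
      have : 0 ≤ α * E * v * S none := by positivity
      simpa [hT', hμ, hlz] using this
    | some none =>
      have h1 := hsecond (some none) (by simp)
      simp only [if_true, hle] at h1
      simp only [hT', Option.elim, if_true, hμ, ha, hle]
      have h2 : (1 - ‖τ‖ ^ 2 / E) * T (some none) ≤ (1 - ‖τ‖ ^ 2 / E) * (v * -(α * E) -
          (-(α * E)) ^ 2 + 2 * α ^ 2 * E * ‖τ‖ ^ 2 - α * E * -(α * E) + α * E * v) :=
        mul_le_mul_of_nonneg_left h1 ha1.le
      have h3 : 0 ≤ 2 * α * v * ‖τ‖ ^ 2 := by positivity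
      have h4 : (1 - ‖τ‖ ^ 2 / E) * T (some none) - 2 * α ^ 2 * E * ‖τ‖ ^ 2 * (1 - ‖τ‖ ^ 2 / E) -
          2 * α * v * ‖τ‖ ^ 2 + E * α ^ 2 * (v ^ 2 + K) ≤
          (v - α * E) * ((1 - ‖τ‖ ^ 2 / E) * -(α * E)) + α * E * v := by
        have h5 : (1 - ‖τ‖ ^ 2 / E) * (α * E * v) ≤ 1 * (α * E * v) :=
          mul_le_mul_of_nonneg_right ha1' (by positivity)
        rw [← haE]
        linarith
      have h5 := mul_le_mul_of_nonneg_right h4 hSi.le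
      linarith
    | some (some k) =>
      have h1 := hsecond (some (some k)) (by simp)
      simp only [Option.some.injEq, reduceCtorEq, if_false, add_zero] at h1
      simp only [hT', Option.elim, hμ, ha, Option.some.injEq, reduceCtorEq, if_false, add_zero,
        one_mul]
      have h5 := mul_le_mul_of_nonneg_right h1 hSi.le
      have h6 : 0 ≤ l (some (some k)) ^ 2 * S (some (some k)) := by positivity
      linarith
  have hsum := Finset.sum_le_sum fun i (_ : i ∈ Finset.univ) => hterm i
  rw [Finset.sum_add_distrib, Finset.sum_add_distrib, Finset.sum_ite_eq' Finset.univ,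
    if_pos (Finset.mem_univ _), ← Finset.mul_sum, ← Finset.mul_sum] at hsum
  have hEuler : ∑ i, μ i * S i = (m + 1) * (genPoly Finset.univ μ).coeff (m + 1) :=
    sum_mul_genPoly_erase _ μ m
  have hcard : ((Finset.univ : Finset (Option (Option (Fin q)))).card : ℝ) = Module.finrank ℝ V := by
    rw [Finset.card_univ, Module.finrank_eq_card_basis b.toBasis]
  have hSsum : ∑ i, S i ≤ Module.finrank ℝ V * S (some none) := by
    refine (sum_genPoly_erase_le _ μ (hpos m (by omega))).trans ?_
    rw [hcard]
    exact mul_le_mul_of_nonneg_left hS1 (Nat.cast_nonneg _)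
  rw [hEuler] at hsum
  have h7 : α * E * v * ∑ i, S i ≤ α * E * v * (Module.finrank ℝ V * S (some none)) :=
    mul_le_mul_of_nonneg_left hSsum (by positivity)
  linarith

end IsGauge

/-! ### Admissibility of the curvatures -/

/-- The Gårding cone `Γ_k` is a connected component of `{σ_k > 0}`: on a connected space, a
continuous family of tuples with `σ_k > 0` which meets the cone stays in the cone. The family is
given through its elementary symmetric functions `f j`. -/
theorem gardingCone_of_preconnected {Y : Type*} [TopologicalSpace Y] [PreconnectedSpace Y]
    {f : ℕ → Y → ℝ} {k n : ℕ} (hf : ∀ j, Continuous (f j))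
    (hreal : ∀ y, ∃ μ : Fin n → ℝ, ∀ j, f j y = (genPoly Finset.univ μ).coeff j)
    (hk : ∀ y, 0 < f k y) {y₀ : Y} (h0 : ∀ j ≤ k, 0 < f j y₀) :
    ∀ y, ∀ j ≤ k, 0 < f j y := by
  set G : Set Y := {y | ∀ j ≤ k, 0 < f j y} with hG
  have hopen : IsOpen G := by
    have : G = ⋂ j ∈ Finset.range (k + 1), {y | 0 < f j y} := by
      ext y; simp [hG]
    rw [this]
    exact isOpen_biInter_finset fun j _ => isOpen_lt continuous_const (hf j)
  have hclosed : IsClosed G := by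
    refine isClosed_of_closure_subset fun y hy => ?_
    have hnn : ∀ j ≤ k, 0 ≤ f j y := fun j hj => by
      have hc : IsClosed {y | 0 ≤ f j y} := isClosed_le continuous_const (hf j)
      exact closure_minimal (fun x (hx : x ∈ G) => (hx j hj).le) hc hy
    have hmac : ∀ j, j + 1 ≤ k → f (j + 1) y ^ j ≤ f j y ^ (j + 1) := fun j hj => by
      have hc : IsClosed {y | f (j + 1) y ^ j ≤ f j y ^ (j + 1)} :=
        isClosed_le ((hf _).pow _) ((hf _).pow _)
      refine closure_minimal (fun x (hx : x ∈ G) => ?_) hc hy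
      obtain ⟨μ, hμ⟩ := hreal x
      simp only [Set.mem_ofPred_eq, hμ]
      exact genPoly_maclaurin _ μ (fun i hi => by rw [← hμ]; exact hx i hi) j hj
    have hind : ∀ d ≤ k, 0 < f (k - d) y := by
      intro d
      induction d with
      | zero => intro _; exact hk y
      | succ d ih =>
        intro hd
        have h1 := ih (by omega)
        have h2 := hmac (k - (d + 1)) (by omega)
        rw [show k - (d + 1) + 1 = k - d by omega] at h2
        refine lt_of_le_of_ne (hnn _ (by omega)) fun h3 => ?_
        rw [← h3, zero_pow (by omega)] at h2
        exact absurd h2 (not_le.2 (pow_pos h1 _))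
    intro j hj
    have := hind (k - j) (by omega)
    rwa [show k - (k - j) = j by omega] at this
  have huniv := IsClopen.eq_univ ⟨hclosed, hopen⟩ ⟨y₀, h0⟩
  intro y
  have : y ∈ G := by rw [huniv]; trivial
  exact this

theorem genPoly_coeff_pos_of_pos {n : ℕ} {κ : Fin n → ℝ} (hκ : ∀ i, 0 < κ i) {j : ℕ} (hj : j ≤ n) :
    0 < (genPoly Finset.univ κ).coeff j := by
  rw [coeff_genPoly]
  exact Finset.sum_pos (fun t _ => Finset.prod_pos fun i _ => hκ i)
    (Finset.powersetCard_nonempty.2 (by simpa using hj))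

section Admissible

variable {n : ℕ} {N : SpaceForm} {ρ : Sph n → ℝ}

/-- At a minimum point on the sphere, the Hessian of a positive gauge is positive definite on the
tangent space. -/
theorem IsGauge.hess_pos_of_isMin {s : Amb n → ℝ} (hs : IsGauge s) {z : Sph n}
    (hz : 0 < s (z : Amb n)) (hmin : ∀ y : Sph n, s (z : Amb n) ≤ s (y : Amb n)) {X : Amb n}
    (hX : inner ℝ (z : Amb n) X = 0) (hX0 : X ≠ 0) :
    0 < (inner ℝ (fderiv ℝ (gradient s) (z : Amb n) X) X : ℝ) := by
  have h0 := sphere_ne_zero z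
  have hz0 : (z : Amb n) + (0 : ℝ) • X = (z : Amb n) := by simp
  set v := s (z : Amb n) with hv
  have hle : ∀ x : Amb n, x ≠ 0 → v * ‖x‖ - s x ≤ 0 := by
    intro x hx
    have h1 := hmin ⟨dir x, by simpa using norm_dir hx⟩
    have h2 : s (dir x) = ‖x‖⁻¹ * s x := hs.smul _ (by positivity) x
    have h3 : 0 < ‖x‖ := norm_pos_iff.2 hx
    rw [h2, inv_mul_eq_div, le_div_iff₀ h3] at h1
    linarith
  have hmax : IsLocalMax (fun t : ℝ => v * ‖(z : Amb n) + t • X‖ - s ((z : Amb n) + t • X)) 0 := by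
    filter_upwards [eventually_line_ne h0 X] with t ht
    refine (hle _ ht).trans (le_of_eq ?_)
    rw [hz0, sphere_norm, hv]; ring
  have hfg : ∀ᶠ t in nhds (0 : ℝ), HasDerivAt
      (fun t : ℝ => v * ‖(z : Amb n) + t • X‖ - s ((z : Amb n) + t • X))
      (v * inner ℝ (dir ((z : Amb n) + t • X)) X - inner ℝ (gradient s ((z : Amb n) + t • X)) X)
      t := by
    filter_upwards [eventually_line_ne h0 X] with t ht
    have h1 := ((hasFDerivAt_norm_amb ht).comp_hasDerivAt t
      (hasDerivAt_line (z : Amb n) X t)).const_mul v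
    have h2 := ((hs.contDiffAt _ ht).differentiableAt (by simp)).hasFDerivAt.comp_hasDerivAt t
      (hasDerivAt_line (z : Amb n) X t)
    rw [inner_gradient_eq]
    exact h1.sub h2
  have hg := (((hasDerivAt_dir_line hX).inner ℝ (hasDerivAt_const (0 : ℝ) X)).const_mul v).sub
    (((hs.differentiableAt_gradient h0).hasDerivAt_line X).inner ℝ (hasDerivAt_const (0 : ℝ) X))
  have hfin := hmax.second_deriv_nonpos hfg hg
  simp only [inner_zero_right, zero_add, real_inner_self_eq_norm_sq] at hfin
  have := mul_pos hz (pow_pos (norm_pos_iff.2 hX0) 2)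
  linarith

/-- If `σ_k` of the principal curvatures is positive, then the curvatures lie in the Gårding cone:
they do at the point farthest from the origin. -/
theorem elemPoly_shapeOp_pos {k : ℕ} (hk : 1 ≤ k) (hkn : k ≤ n)
    (hs : IsGauge (gaugeFn N ρ)) (hρ : ∀ z, 0 < ρ z) (hφ : ∀ z, 0 < N.phi (ρ z))
    (hcot : ∀ z, 0 < N.cot (ρ z)) (h : ∀ z : Sph n, ContDiffAt ℝ 3 (homExt ρ) (z : Amb n))
    {ν : Sph n → Amb n} {κ : Sph n → Fin n → ℝ} (hν : ∀ z, IsOuterUnitNormal N ρ z (ν z))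
    (hκ : ∀ z, ArePrincipalCurvatures N ρ z (ν z) (κ z)) (hσ : ∀ z, 0 < sigmaK k (κ z)) :
    ∀ z : Sph n, ∀ j ≤ k, 0 < (elemPoly (shapeOp N.curv (gaugeFn N ρ) (z : Amb n))).coeff j := by
  have hcoeff : ∀ (z : Sph n) (j : ℕ), (elemPoly (shapeOp N.curv (gaugeFn N ρ) (z : Amb n))).coeff j =
      shapeScale N ρ z ^ j * (genPoly Finset.univ (κ z)).coeff j := fun z j =>
    elemPoly_shapeOp_coeff hs (hρ z) (hφ z) (h z) (hν z) (hκ z) j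
  have hw : ∀ z, 0 < shapeScale N ρ z := fun z => shapeScale_pos hs (hφ z)
  have hrank : 1 < Module.rank ℝ (Amb n) := by
    rw [← Module.finrank_eq_rank, finrank_euclideanSpace_fin]
    exact_mod_cast (by omega : 1 < n + 1)
  have : PreconnectedSpace (Sph n) :=
    Subtype.preconnectedSpace (isPreconnected_sphere hrank 0 1)
  have : Nonempty (Sph n) := (isConnected_sphere hrank 0 zero_le_one).nonempty.to_subtype
  have hcont : Continuous fun z : Sph n => gaugeFn N ρ (z : Amb n) := by
    rw [continuous_iff_continuousAt]
    exact fun z => ((hs.contDiffAt _ (sphere_ne_zero z)).continuousAt).comp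
      continuous_subtype_val.continuousAt
  obtain ⟨z₀, hz₀⟩ := hcont.exists_forall_le' (x₀ := Classical.arbitrary _) (by simp)
  refine gardingCone_of_preconnected (n := n) (y₀ := z₀) (fun j => ?_) (fun z => ?_) (fun z => ?_) ?_
  · rw [continuous_iff_continuousAt]
    intro z
    have h1 := (hs.differentiableAt_shapeOp (K := N.curv) (sphere_ne_zero z)
      (energy_gaugeFn_pos hs (hφ z).ne').ne').continuousAt
    have h2 : ContinuousAt (fun y : Sph n => shapeOp N.curv (gaugeFn N ρ) (y : Amb n)) z :=
      h1.comp continuous_subtype_val.continuousAt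
    exact (continuous_elemPoly_coeff j).continuousAt.comp h2
  · exact ⟨fun i => shapeScale N ρ z * κ z i, fun j => by rw [hcoeff, genPoly_smul_coeff]⟩
  · rw [hcoeff, ← sigmaK_eq_coeff]
    exact mul_pos (pow_pos (hw z) k) (hσ z)
  · intro j hj
    rw [hcoeff]
    refine mul_pos (pow_pos (hw z₀) j) (genPoly_coeff_pos_of_pos (fun i => ?_) (hj.trans hkn))
    obtain ⟨e, hez, heg, heh⟩ := hκ z₀
    have h1 := heh i i
    have hei : e i ≠ 0 := by
      intro h0
      have h2 := heg i i
      rw [metricN_pushTangent (hρ z₀) (hφ z₀) (h z₀) (hez i) (hez i), h0] at h2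
      simp at h2
    rw [if_pos rfl, secondFF_eq_hess hs (hρ z₀) (hφ z₀) (h z₀) (hν z₀) (hez i) (hez i)] at h1
    rw [← h1]
    have h3 := hs.hess_pos_of_isMin (z := z₀) (by rw [gaugeFn_sphere]; exact hcot z₀) hz₀
      (hez i) hei
    have := hw z₀
    have := hφ z₀
    positivity

end Admissible

/-! ### Bounds for the prescribed function -/

/-- A `C¹` function on a compact set has uniformly bounded derivatives within the set. -/
theorem ContDiffOn.exists_bound_fderivWithin {E F : Type*} [NormedAddCommGroup E] [NormedSpace ℝ E]
    [NormedAddCommGroup F] [NormedSpace ℝ F] {f : E → F} {S : Set E} (hf : ContDiffOn ℝ 1 f S)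
    (hS : IsCompact S) : ∃ L : ℝ, 0 ≤ L ∧ ∀ p ∈ S, ∃ f' : E →L[ℝ] F,
      HasFDerivWithinAt f f' S p ∧ ‖f'‖ ≤ L := by
  refine hS.induction_on (p := fun T => ∃ L : ℝ, 0 ≤ L ∧ ∀ p ∈ T, ∃ f' : E →L[ℝ] F,
      HasFDerivWithinAt f f' S p ∧ ‖f'‖ ≤ L) ⟨0, le_rfl, by simp⟩ ?_ ?_ ?_
  · rintro T U hTU ⟨L, hL, h⟩
    exact ⟨L, hL, fun p hp => h p (hTU hp)⟩
  · rintro T U ⟨L, hL, h⟩ ⟨L', hL', h'⟩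
    refine ⟨max L L', le_max_of_le_left hL, ?_⟩
    rintro p (hp | hp)
    · obtain ⟨f', h1, h2⟩ := h p hp
      exact ⟨f', h1, h2.trans (le_max_left _ _)⟩
    · obtain ⟨f', h1, h2⟩ := h' p hp
      exact ⟨f', h1, h2.trans (le_max_right _ _)⟩
  · intro x hx
    obtain ⟨u, hu, -, -, f', hf', hc⟩ :=
      (contDiffWithinAt_succ_iff_hasFDerivWithinAt' (n := 0) (by simp)).1 (by simpa using hf x hx)
    rw [Set.insert_eq_of_mem hx] at hu
    have hcx : ContinuousWithinAt f' S x := hc.continuousWithinAt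
    have hb : ∀ᶠ y in nhdsWithin x S, ‖f' y‖ < ‖f' x‖ + 1 :=
      hcx.norm.eventually_lt_const (by linarith)
    refine ⟨u ∩ {y | ‖f' y‖ < ‖f' x‖ + 1}, Filter.inter_mem hu hb, ‖f' x‖ + 1, by positivity, ?_⟩
    rintro p ⟨hp1, hp2⟩
    exact ⟨f' p, hf' p hp1, le_of_lt hp2⟩

theorem isCompact_dataShell (N : SpaceForm) (n : ℕ) (R₁ R₂ : ℝ) :
    IsCompact (dataShell N n R₁ R₂) := by
  refine Metric.isCompact_of_isClosed_isBounded ?_ ?_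
  · exact (isClosed_le continuous_const continuous_fst.norm).inter
      ((isClosed_le continuous_fst.norm continuous_const).inter
        (isClosed_eq continuous_snd.norm continuous_const))
  · refine (Metric.isBounded_closedBall (x := (0 : Amb n × Amb n))
      (r := max (N.phi R₂) 1)).subset ?_
    rintro ⟨x, y⟩ ⟨-, h2, h3⟩
    rw [mem_closedBall_zero_iff]
    exact max_le_max h2 h3.le

/-! ### The right-hand side along the spherical gradient -/

section RightHandSide

variable {n : ℕ} {N : SpaceForm} {ρ : Sph n → ℝ} {z : Sph n} {α : ℝ}

/-- The outward unit normal of the graph, transported to the unit sphere along radial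
geodesics. -/
noncomputable def unitNormal (N : SpaceForm) (ρ : Sph n → ℝ) (z : Sph n) : Amb n :=
  (shapeScale N ρ z)⁻¹ • ((z : Amb n) + N.phi (ρ z) • tangGrad (gaugeFn N ρ) (z : Amb n))

theorem norm_unitNormal (hs : IsGauge (gaugeFn N ρ)) (hφ : 0 < N.phi (ρ z)) :
    ‖unitNormal N ρ z‖ = 1 := by
  have hw := shapeScale_pos hs hφ
  have h1 : ‖(z : Amb n) + N.phi (ρ z) • tangGrad (gaugeFn N ρ) (z : Amb n)‖ ^ 2 =
      shapeScale N ρ z ^ 2 := by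
    rw [norm_add_sq_real, inner_smul_right, hs.inner_self_tangGrad (sphere_norm z), sphere_norm,
      norm_smul, Real.norm_of_nonneg hφ.le, shapeScale_sq hs hφ.ne']
    ring
  rw [unitNormal, norm_smul, norm_inv, Real.norm_of_nonneg hw.le,
    (pow_left_inj₀ (norm_nonneg _) hw.le two_ne_zero).1 h1, inv_mul_cancel₀ hw.ne']

/-- The point of the sphere in the direction of `z + t τ`. -/
noncomputable def sphereCurve (z : Sph n) {τ : Amb n} (hτ : inner ℝ (z : Amb n) τ = (0 : ℝ))
    (t : ℝ) : Sph n :=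
  ⟨dir ((z : Amb n) + t • τ), by
    have h : (z : Amb n) + t • τ ≠ 0 := by
      intro h0
      have h1 := congrArg (fun y => (inner ℝ (z : Amb n) y : ℝ)) h0
      simp [inner_add_right, inner_smul_right, hτ] at h1
    simpa using norm_dir h⟩

variable {τ : Amb n} (hτ : inner ℝ (z : Amb n) τ = (0 : ℝ))

theorem sphereCurve_zero : sphereCurve z hτ 0 = z :=
  Subtype.ext (by simp [sphereCurve, dir_of_norm_one (sphere_norm z)])

theorem hasDerivAt_sphereCurve : HasDerivAt (fun t => (sphereCurve z hτ t : Amb n)) τ 0 :=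
  hasDerivAt_dir_line hτ

theorem apply_sphereCurve (t : ℝ) (h : (z : Amb n) + t • τ ≠ 0) :
    ρ (sphereCurve z hτ t) = homExt ρ ((z : Amb n) + t • τ) := by
  rw [homExt_eq h]; rfl

variable (hs : IsGauge (gaugeFn N ρ)) (h : ContDiffAt ℝ 3 (homExt ρ) (z : Amb n))
  (hφ : 0 < N.phi (ρ z)) (hτdef : τ = tangGrad (gaugeFn N ρ) (z : Amb n))

include h hφ hτdef

theorem hasDerivAt_phi_sphereCurve : HasDerivAt (fun t => N.phi (ρ (sphereCurve z hτ t)))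
    (-(N.cot (ρ z) * N.phi (ρ z) ^ 3 * ‖τ‖ ^ 2)) 0 := by
  have h1 := (h.differentiableAt (by simp)).hasDerivAt_line τ
  rw [fderiv_homExt_eq (N := N) (h.differentiableAt (by simp)) hφ.ne', ← hτdef,
    real_inner_self_eq_norm_sq] at h1
  have h2 : HasDerivAt (fun t => ρ (sphereCurve z hτ t)) _ 0 :=
    h1.congr_of_eventuallyEq ((eventually_line_ne (sphere_ne_zero z) τ).mono fun t ht =>
      apply_sphereCurve hτ t ht)
  have h3 := (N.hasDerivAt_phi (ρ (sphereCurve z hτ 0))).comp (0 : ℝ) h2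
  refine h3.congr_deriv ?_
  rw [sphereCurve_zero, SpaceForm.cot]
  field_simp

include hs

variable (hH : fderiv ℝ (gradient (gaugeFn N ρ)) (z : Amb n) τ =
  (-(α * energy N.curv (gaugeFn N ρ) (z : Amb n))) • τ)

include hH

theorem hasDerivAt_shapeScale_sphereCurve :
    HasDerivAt (fun t => shapeScale N ρ (sphereCurve z hτ t))
      (-(shapeScale N ρ z * ((N.cot (ρ z) * N.phi (ρ z) ^ 2 + α) * ‖τ‖ ^ 2))) 0 := by
  have hE := energy_gaugeFn_pos hs hφ.ne'
  have hpτ : (inner ℝ (gradient (gaugeFn N ρ) (z : Amb n)) τ : ℝ) = ‖τ‖ ^ 2 := by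
    rw [hτdef]; exact hs.inner_gradient_tangGrad (sphere_norm z)
  have h1 := hasDerivAt_phi_sphereCurve hτ h hφ hτdef
  have h2 := hs.hasDerivAt_energy_curve (K := N.curv) (sphere_ne_zero z)
    (γ := fun t => (sphereCurve z hτ t : Amb n)) (by rw [sphereCurve_zero])
    (hasDerivAt_sphereCurve hτ)
  rw [hH, inner_smul_right, hpτ] at h2
  have h3 := h1.mul (h2.sqrt (by rw [sphereCurve_zero]; exact hE.ne'))
  refine h3.congr_deriv ?_
  rw [sphereCurve_zero, shapeScale]
  have h4 := Real.sqrt_pos.2 hE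
  have h5 := Real.sq_sqrt hE.le
  field_simp
  rw [h5]
  ring

theorem hasDerivAt_unitNormal_sphereCurve :
    HasDerivAt (fun t => unitNormal N ρ (sphereCurve z hτ t))
      ((shapeScale N ρ z)⁻¹ •
        (((N.cot (ρ z) * N.phi (ρ z) ^ 2 + α - N.phi (ρ z)) * ‖τ‖ ^ 2) • (z : Amb n) +
          (1 - α / N.phi (ρ z) - N.phi (ρ z) * N.cot (ρ z)) • τ)) 0 := by
  have hw := shapeScale_pos hs hφ
  have hE := energy_gaugeFn (z := z) hs hφ.ne'
  have hpτ : (inner ℝ (gradient (gaugeFn N ρ) (z : Amb n)) τ : ℝ) = ‖τ‖ ^ 2 := by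
    rw [hτdef]; exact hs.inner_gradient_tangGrad (sphere_norm z)
  have h1 := hasDerivAt_phi_sphereCurve hτ h hφ hτdef
  have h2 := hasDerivAt_shapeScale_sphereCurve hτ hs h hφ hτdef hH
  have h3 := hs.hasDerivAt_tangGrad_curve (sphere_ne_zero z)
    (γ := fun t => (sphereCurve z hτ t : Amb n)) (by rw [sphereCurve_zero])
    (hasDerivAt_sphereCurve hτ)
  rw [hH, hpτ, gaugeFn_sphere] at h3
  have h4 := (h2.inv (by rw [sphereCurve_zero]; exact hw.ne')).smul
    ((hasDerivAt_sphereCurve hτ).add (h1.smul h3))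
  refine h4.congr_deriv ?_
  simp only [Pi.inv_apply, Pi.add_apply, Pi.smul_apply', sphereCurve_zero, ← hτdef]
  rw [← hτdef] at hE
  rw [hE]
  match_scalars
  · field_simp
    ring
  · field_simp
    ring

end RightHandSide

namespace SpaceForm

theorem phi_le_phi (N : SpaceForm) {r r' : ℝ} (h0 : 0 < r) (h : r ≤ r')
    (hr : (r' : EReal) < N.outerRadius) : N.phi r ≤ N.phi r' := by
  cases N
  · exact h
  · have : r' < Real.pi / 2 := EReal.coe_lt_coe_iff.1 hr
    exact Real.sin_le_sin_of_le_of_le_pi_div_two (by linarith [Real.pi_pos]) this.le h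
  · exact Real.sinh_le_sinh.2 h

theorem neg_one_le_curv (N : SpaceForm) : -1 ≤ N.curv := by
  cases N <;> simp [curv]

end SpaceForm

section Estimate

variable {n : ℕ} {N : SpaceForm} {ρ : Sph n → ℝ} {z : Sph n} {α R₁ R₂ : ℝ}
  {ψ : Amb n × Amb n → ℝ}

theorem mem_dataShell (hs : IsGauge (gaugeFn N ρ)) (hφ : 0 < N.phi (ρ z))
    (h1 : N.phi R₁ ≤ N.phi (ρ z)) (h2 : N.phi (ρ z) ≤ N.phi R₂) :
    (N.phi (ρ z) • (z : Amb n), unitNormal N ρ z) ∈ dataShell N n R₁ R₂ := by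
  have h3 : ‖N.phi (ρ z) • (z : Amb n)‖ = N.phi (ρ z) := by
    rw [norm_smul, sphere_norm, Real.norm_of_nonneg hφ.le, mul_one]
  exact ⟨h3.symm ▸ h1, h3.symm ▸ h2, norm_unitNormal hs hφ⟩

/-- The derivative of the right-hand side `(φ √E)^k ψ(V, ν)` in the direction of the spherical
gradient at a critical point of the test function. The radial derivative of `φ^k ψ` enters
with a favourable sign, which is the hypothesis `hmono`. -/
theorem exists_deriv_rhs_ge {k : ℕ} {L : ℝ} {τ : Amb n} (hτ : inner ℝ (z : Amb n) τ = (0 : ℝ))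
    (hs : IsGauge (gaugeFn N ρ)) (h : ContDiffAt ℝ 3 (homExt ρ) (z : Amb n))
    (hφ : ∀ z, 0 < N.phi (ρ z)) (hφ1 : ∀ z, N.phi R₁ ≤ N.phi (ρ z))
    (hφ2 : ∀ z, N.phi (ρ z) ≤ N.phi R₂) (hcot : 0 < N.cot (ρ z))
    (hτdef : τ = tangGrad (gaugeFn N ρ) (z : Amb n))
    (hH : fderiv ℝ (gradient (gaugeFn N ρ)) (z : Amb n) τ =
      (-(α * energy N.curv (gaugeFn N ρ) (z : Amb n))) • τ)
    {ψ' : Amb n × Amb n →L[ℝ] ℝ}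
    (hψ' : HasFDerivWithinAt ψ ψ' (dataShell N n R₁ R₂)
      (N.phi (ρ z) • (z : Amb n), unitNormal N ρ z)) (hL : ‖ψ'‖ ≤ L)
    (hmono : (k + 1) * ψ (N.phi (ρ z) • (z : Amb n), unitNormal N ρ z) +
      N.phi (ρ z) * ψ' ((z : Amb n), 0) ≤ 0) :
    ∃ D : ℝ, HasDerivAt (fun t => shapeScale N ρ (sphereCurve z hτ t) ^ (k + 1) *
        ψ (N.phi (ρ (sphereCurve z hτ t)) • (sphereCurve z hτ t : Amb n),
          unitNormal N ρ (sphereCurve z hτ t))) D 0 ∧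
      -(shapeScale N ρ z ^ (k + 1) * ((k + 1) * α * ‖τ‖ ^ 2 *
        ψ (N.phi (ρ z) • (z : Amb n), unitNormal N ρ z) + L * (N.phi (ρ z) * ‖τ‖ +
          (shapeScale N ρ z)⁻¹ *
            (|N.cot (ρ z) * N.phi (ρ z) ^ 2 + α - N.phi (ρ z)| * ‖τ‖ ^ 2 +
              |1 - α / N.phi (ρ z) - N.phi (ρ z) * N.cot (ρ z)| * ‖τ‖)))) ≤ D := by
  have h1 := hasDerivAt_phi_sphereCurve hτ h (hφ z) hτdef
  have h2 := hasDerivAt_shapeScale_sphereCurve hτ hs h (hφ z) hτdef hH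
  have h3 := hasDerivAt_unitNormal_sphereCurve hτ hs h (hφ z) hτdef hH
  set w := shapeScale N ρ z with hwdef
  have hw : 0 < w := shapeScale_pos hs (hφ z)
  set ν' : Amb n := w⁻¹ •
        (((N.cot (ρ z) * N.phi (ρ z) ^ 2 + α - N.phi (ρ z)) * ‖τ‖ ^ 2) • (z : Amb n) +
          (1 - α / N.phi (ρ z) - N.phi (ρ z) * N.cot (ρ z)) • τ) with hν'
  have h4 := hψ'.comp_hasDerivAt_of_eq (0 : ℝ)
    ((h1.smul (hasDerivAt_sphereCurve hτ)).prodMk h3)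
    (Filter.Eventually.of_forall fun t => mem_dataShell hs (hφ _) (hφ1 _) (hφ2 _))
    (by simp only [Pi.smul_apply', sphereCurve_zero])
  have h5 := (h2.pow (k + 1)).mul h4
  refine ⟨_, h5, ?_⟩
  simp only [Pi.pow_apply, Function.comp_apply, Pi.smul_apply', sphereCurve_zero,
    Nat.add_sub_cancel, ← hwdef]
  set f := N.phi (ρ z) with hf
  set v := N.cot (ρ z) with hv
  set Ψ := ψ (f • (z : Amb n), unitNormal N ρ z) with hΨ
  -- split the variation into its radial and its remaining part
  have hsplit : ψ' (f • τ + (-(v * f ^ 3 * ‖τ‖ ^ 2)) • (z : Amb n), ν') =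
      -(v * f ^ 3 * ‖τ‖ ^ 2) * ψ' ((z : Amb n), 0) + ψ' (f • τ, ν') := by
    have : (f • τ + (-(v * f ^ 3 * ‖τ‖ ^ 2)) • (z : Amb n), ν') =
        (-(v * f ^ 3 * ‖τ‖ ^ 2)) • ((z : Amb n), (0 : Amb n)) + (f • τ, ν') :=
      Prod.ext (by simp [add_comm]) (by simp)
    rw [this, map_add, map_smul, smul_eq_mul]
  have hνn : ‖ν'‖ ≤ w⁻¹ * (|v * f ^ 2 + α - f| * ‖τ‖ ^ 2 + |1 - α / f - f * v| * ‖τ‖) := by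
    rw [hν', norm_smul, norm_inv, Real.norm_of_nonneg hw.le]
    refine mul_le_mul_of_nonneg_left ((norm_add_le _ _).trans (le_of_eq ?_)) (by positivity)
    rw [norm_smul, norm_smul, sphere_norm, Real.norm_eq_abs, Real.norm_eq_abs, abs_mul,
      abs_of_nonneg (sq_nonneg ‖τ‖), mul_one]
  have hfpos : 0 < f := hφ z
  have hrest : -(L * (f * ‖τ‖ + w⁻¹ * (|v * f ^ 2 + α - f| * ‖τ‖ ^ 2 +
      |1 - α / f - f * v| * ‖τ‖))) ≤ ψ' (f • τ, ν') := by
    have h6 := (abs_le.1 ((Real.norm_eq_abs _).symm.le.trans (ψ'.le_opNorm (f • τ, ν')))).1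
    refine le_trans (neg_le_neg ?_) h6
    have h7 : ‖(f • τ, ν')‖ ≤ f * ‖τ‖ + ‖ν'‖ := by
      rw [Prod.norm_mk, norm_smul, Real.norm_of_nonneg hfpos.le]
      exact max_le_add_of_nonneg (by positivity) (norm_nonneg _)
    have hL0 : 0 ≤ L := (norm_nonneg _).trans hL
    calc ‖ψ'‖ * ‖(f • τ, ν')‖ ≤ L * (f * ‖τ‖ + ‖ν'‖) := by gcongr
      _ ≤ _ := by gcongr
  rw [hsplit]
  have h8 : 0 ≤ -(v * f ^ 2 * ‖τ‖ ^ 2) * ((k + 1) * Ψ + f * ψ' ((z : Amb n), 0)) :=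
    mul_nonneg_of_nonpos_of_nonpos (neg_nonpos.2 (by positivity)) hmono
  have h9 := mul_le_mul_of_nonneg_left (add_le_add h8 hrest) (pow_pos hw (k + 1)).le
  refine le_trans (le_of_eq ?_) ((add_le_add_left h9
    (-(w ^ (k + 1) * ((k + 1) * α * ‖τ‖ ^ 2 * Ψ)))).trans (le_of_eq ?_))
  · ring
  · push_cast
    ring

end Estimate

/-! ### The maximum principle -/

/-- The inequality between real numbers to which the maximum principle reduces. Here `T = |τ|`,
`w = φ √E`, and the right-hand side of `hbig` grows quadratically in `α`. -/
theorem false_of_maximum_inequalities {m : ℕ} {α f v E T w Ψ L M₀ m₀ S D d : ℝ} (hα : 0 < α)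
    (hf : 0 < f) (hv : 0 < v) (hT : 0 ≤ T) (hE1 : 1 < E) (hE : E = T ^ 2 + (f ^ 2)⁻¹)
    (hw : w = f * √E) (hL : 0 ≤ L) (hm₀ : 0 < m₀) (hΨ : 0 < Ψ) (hΨM : Ψ ≤ M₀)
    (hS : w ^ m * m₀ ≤ S)
    (hD : -(w ^ (m + 1) * ((m + 1) * α * T ^ 2 * Ψ + L * (f * T + w⁻¹ *
      (|v * f ^ 2 + α - f| * T ^ 2 + |1 - α / f - f * v| * T)))) ≤ D)
    (hle : D + S * E * (α ^ 2 * (f ^ 2)⁻¹ - α * v * d) ≤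
      (v - α * E) * ((m + 1) * (w ^ (m + 1) * Ψ)))
    (hbig : f * (v * ((m + 1) * M₀) + L * (f + f⁻¹ *
      ((v * f ^ 2 + α + f) + (1 + α / f + f * v)))) < m₀ * (α ^ 2 * (f ^ 2)⁻¹ - α * v * d)) :
    False := by
  have he1 : 1 ≤ √E := Real.one_le_sqrt.2 hE1.le
  have hee : √E ^ 2 = E := Real.sq_sqrt (by linarith)
  have hfi : 0 < (f ^ 2)⁻¹ := by positivity
  have hTe : T ≤ √E := Real.le_sqrt_of_sq_le (by linarith)
  set e := √E with he
  have he0 : 0 < e := by linarith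
  have hwpos : 0 < w := by rw [hw]; positivity
  set Q := α ^ 2 * (f ^ 2)⁻¹ - α * v * d with hQ
  set A := v * f ^ 2 + α + f with hA
  set B := 1 + α / f + f * v with hB
  have hA0 : 0 < A := by positivity
  have hB0 : 0 < B := by positivity
  have hM0 : 0 < M₀ := hΨ.trans_le hΨM
  have hQ0 : 0 < Q := by
    have h1 : 0 ≤ f * (v * ((m + 1) * M₀) + L * (f + f⁻¹ * (A + B))) := by positivity
    exact pos_of_mul_pos_right (h1.trans_lt hbig) hm₀.le
  set X := L * (f * T + w⁻¹ * (|v * f ^ 2 + α - f| * T ^ 2 + |1 - α / f - f * v| * T)) with hX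
  have hX1 : X ≤ e * (L * (f + f⁻¹ * (A + B))) := by
    have hA1 : |v * f ^ 2 + α - f| ≤ A := by
      have h1 : 0 < v * f ^ 2 := by positivity
      rw [abs_le]; constructor <;> linarith
    have hB1 : |1 - α / f - f * v| ≤ B := by
      have h1 : 0 < α / f := by positivity
      have h2 : 0 < f * v := by positivity
      rw [abs_le]; constructor <;> linarith
    have h1 : |v * f ^ 2 + α - f| * T ^ 2 + |1 - α / f - f * v| * T ≤ A * e ^ 2 + B * e ^ 2 := by
      have h2 : T ≤ e ^ 2 := hTe.trans (le_self_pow₀ he1 two_ne_zero)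
      gcongr
    calc X ≤ L * (f * e + w⁻¹ * (A * e ^ 2 + B * e ^ 2)) := by rw [hX]; gcongr
      _ = _ := by rw [hw]; field_simp
  have h1 : w ^ m * (m₀ * E * Q) ≤ w ^ m * (w * ((m + 1) * v * Ψ + X)) := by
    calc w ^ m * (m₀ * E * Q) = (w ^ m * m₀) * (E * Q) := by ring
      _ ≤ S * (E * Q) := by gcongr
      _ ≤ (v - α * E) * ((m + 1) * (w ^ (m + 1) * Ψ)) +
          w ^ (m + 1) * ((m + 1) * α * T ^ 2 * Ψ + X) := by linarith
      _ = w ^ (m + 1) * ((m + 1) * v * Ψ + X) -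
          (m + 1) * α * (f ^ 2)⁻¹ * (w ^ (m + 1) * Ψ) := by rw [hE]; ring
      _ ≤ w ^ (m + 1) * ((m + 1) * v * Ψ + X) := sub_le_self _ (by positivity)
      _ = _ := by ring
  have h2 : m₀ * E * Q ≤ w * ((m + 1) * v * Ψ + X) := le_of_mul_le_mul_left h1 (by positivity)
  have h3 : (m + 1) * v * Ψ ≤ e * (v * ((m + 1) * M₀)) := by
    calc (m + 1) * v * Ψ ≤ (m + 1) * v * M₀ := by gcongr
      _ = 1 * (v * ((m + 1) * M₀)) := by ring
      _ ≤ _ := by gcongr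
  have h4 : e ^ 2 * (m₀ * Q) ≤ e ^ 2 * (f * (v * ((m + 1) * M₀) + L * (f + f⁻¹ * (A + B)))) := by
    calc e ^ 2 * (m₀ * Q) = m₀ * E * Q := by rw [hee]; ring
      _ ≤ w * (e * (v * ((m + 1) * M₀)) + e * (L * (f + f⁻¹ * (A + B)))) :=
          h2.trans (by gcongr)
      _ = _ := by rw [hw]; ring
  have h5 := le_of_mul_le_mul_left h4 (by positivity)
  linarith

section MaximumPrinciple

variable {n : ℕ} {N : SpaceForm} {ρ : Sph n → ℝ} {z : Sph n} {α R₁ R₂ : ℝ}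
  {ψ : Amb n × Amb n → ℝ}

/-- The radial monotonicity of `φ^k ψ` in terms of the derivative of `ψ` within the shell. -/
theorem radial_deriv_nonpos {m : ℕ} (hR₁ : 0 < R₁) (hR₂ : (R₂ : EReal) < N.outerRadius)
    {ν : Sph n} {r : ℝ} (hr : r ∈ Set.Ioo R₁ R₂)
    (hmono : deriv (fun t : ℝ => N.phi t ^ (m + 1) *
      ψ (N.phi t • (z : Amb n), (ν : Amb n))) r ≤ 0) {ψ' : Amb n × Amb n →L[ℝ] ℝ}
    (hψ' : HasFDerivWithinAt ψ ψ' (dataShell N n R₁ R₂) (N.phi r • (z : Amb n), (ν : Amb n))) :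
    (m + 1) * ψ (N.phi r • (z : Amb n), (ν : Amb n)) + N.phi r * ψ' ((z : Amb n), 0) ≤ 0 := by
  have hlt : ∀ t ∈ Set.Ioo R₁ R₂, (t : EReal) < N.outerRadius := fun t ht =>
    lt_trans (EReal.coe_lt_coe_iff.2 ht.2) hR₂
  have hφ := N.phi_pos (hR₁.trans hr.1) (hlt r hr)
  have hd := N.dphi_pos (hR₁.trans hr.1) (hlt r hr)
  have h1 := (N.hasDerivAt_phi r).smul_const (z : Amb n)
  have hmem : ∀ᶠ t in nhds r, (N.phi t • (z : Amb n), (ν : Amb n)) ∈ dataShell N n R₁ R₂ := by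
    filter_upwards [Ioo_mem_nhds hr.1 hr.2] with t ht
    have h3 : ‖N.phi t • (z : Amb n)‖ = N.phi t := by
      rw [norm_smul, sphere_norm, Real.norm_of_nonneg
        (N.phi_pos (hR₁.trans ht.1) (hlt t ht)).le, mul_one]
    exact ⟨h3.symm ▸ N.phi_le_phi hR₁ ht.1.le (hlt t ht),
      h3.symm ▸ N.phi_le_phi (hR₁.trans ht.1) ht.2.le hR₂, sphere_norm ν⟩
  have h2 := hψ'.comp_hasDerivAt r (h1.prodMk (hasDerivAt_const r (ν : Amb n))) hmem
  have h3 := ((N.hasDerivAt_phi r).pow (m + 1)).mul h2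
  have h4 : deriv (fun t : ℝ => N.phi t ^ (m + 1) * ψ (N.phi t • (z : Amb n), (ν : Amb n))) r = _ :=
    h3.deriv
  rw [h4] at hmono
  have h5 : ψ' (N.dphi r • (z : Amb n), 0) = N.dphi r * ψ' ((z : Amb n), 0) := by
    rw [← smul_eq_mul, ← map_smul]
    congr 1
    simp
  rw [h5] at hmono
  simp only [Pi.pow_apply, Function.comp_apply, Nat.add_sub_cancel] at hmono
  push_cast at hmono
  have h6 : (N.phi r ^ m * N.dphi r) * ((m + 1) * ψ (N.phi r • (z : Amb n), (ν : Amb n)) +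
      N.phi r * ψ' ((z : Amb n), 0)) ≤ 0 := by
    refine le_trans (le_of_eq ?_) hmono
    ring
  exact nonpos_of_mul_nonpos_right h6 (by positivity)

/-- A point of the sphere where `ρ` attains a bound is a critical point. -/
theorem mem_Ioo_of_tangGrad_ne_zero (h : ContDiffAt ℝ 3 (homExt ρ) (z : Amb n))
    (hφ : N.phi (ρ z) ≠ 0) (hR : ∀ z, R₁ ≤ ρ z ∧ ρ z ≤ R₂)
    (hτ : tangGrad (gaugeFn N ρ) (z : Amb n) ≠ 0) : ρ z ∈ Set.Ioo R₁ R₂ := by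
  have key : fderiv ℝ (homExt ρ) (z : Amb n) ≠ 0 := by
    intro h0
    have h1 := fderiv_homExt_eq (h.differentiableAt (by simp)) hφ
      (tangGrad (gaugeFn N ρ) (z : Amb n))
    rw [h0, real_inner_self_eq_norm_sq, zero_apply] at h1
    have h2 := norm_pos_iff.2 hτ
    have h3 : 0 < N.phi (ρ z) ^ 2 * ‖tangGrad (gaugeFn N ρ) (z : Amb n)‖ ^ 2 := by positivity
    linarith
  have hev : ∀ᶠ x in nhds (z : Amb n), R₁ ≤ homExt ρ x ∧ homExt ρ x ≤ R₂ := by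
    filter_upwards [isOpen_ne.mem_nhds (sphere_ne_zero z)] with x hx
    rw [homExt_eq hx]; exact hR _
  refine ⟨lt_of_le_of_ne (hR z).1 fun h1 => key ?_, lt_of_le_of_ne (hR z).2 fun h1 => key ?_⟩
  · refine IsLocalMin.fderiv_eq_zero (hev.mono fun x hx => ?_)
    rw [homExt_sphere, ← h1]; exact hx.1
  · refine IsLocalMax.fderiv_eq_zero (hev.mono fun x hx => ?_)
    rw [homExt_sphere, h1]; exact hx.2

/-- The maximum principle: if `α` is large, then `E` is bounded at a maximum point of
`log √E + α v`. -/
theorem energy_le_of_isLocalMax {m : ℕ} {L M₀ m₀ : ℝ} (hα : 0 < α)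
    (hR₁ : 0 < R₁) (hR₂ : (R₂ : EReal) < N.outerRadius) (hR : ∀ z, R₁ ≤ ρ z ∧ ρ z ≤ R₂)
    (hs : IsGauge (gaugeFn N ρ)) (h : ∀ z : Sph n, ContDiffAt ℝ 3 (homExt ρ) (z : Amb n))
    (hψ' : ∀ p ∈ dataShell N n R₁ R₂, ∃ ψ' : Amb n × Amb n →L[ℝ] ℝ,
      HasFDerivWithinAt ψ ψ' (dataShell N n R₁ R₂) p ∧ ‖ψ'‖ ≤ L)
    (hm₀ : 0 < m₀) (hm₁ : m₀ ≤ 1) (hψ : ∀ p ∈ dataShell N n R₁ R₂, m₀ ≤ ψ p ∧ ψ p ≤ M₀)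
    (hmono : ∀ z ν : Sph n, ∀ r ∈ Set.Ioo R₁ R₂, deriv (fun t : ℝ => N.phi t ^ (m + 1) *
      ψ (N.phi t • (z : Amb n), (ν : Amb n))) r ≤ 0)
    {μ : Fin n → ℝ} (hμ : ∀ j, (elemPoly (shapeOp N.curv (gaugeFn N ρ) (z : Amb n))).coeff j =
      (genPoly Finset.univ μ).coeff j)
    (hpos : ∀ j ≤ m + 1, 0 < (elemPoly (shapeOp N.curv (gaugeFn N ρ) (z : Amb n))).coeff j)
    (heq : ∀ y : Sph n, (elemPoly (shapeOp N.curv (gaugeFn N ρ) (y : Amb n))).coeff (m + 1) =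
      shapeScale N ρ y ^ (m + 1) * ψ (N.phi (ρ y) • (y : Amb n), unitNormal N ρ y))
    (hmax : IsLocalMax (IsGauge.testFn N.curv α (gaugeFn N ρ)) (z : Amb n))
    (hbig : N.phi (ρ z) * (N.cot (ρ z) * ((m + 1) * M₀) + L * (N.phi (ρ z) + (N.phi (ρ z))⁻¹ *
      ((N.cot (ρ z) * N.phi (ρ z) ^ 2 + α + N.phi (ρ z)) +
        (1 + α / N.phi (ρ z) + N.phi (ρ z) * N.cot (ρ z))))) <
      m₀ * (α ^ 2 * (N.phi (ρ z) ^ 2)⁻¹ - α * N.cot (ρ z) * (n + 1))) :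
    energy N.curv (gaugeFn N ρ) (z : Amb n) ≤ max 1 (N.phi (ρ z) ^ 2)⁻¹ := by
  have hlt : ∀ y, (ρ y : EReal) < N.outerRadius := fun y =>
    lt_of_le_of_lt (EReal.coe_le_coe_iff.2 (hR y).2) hR₂
  have hρ : ∀ y, 0 < ρ y := fun y => hR₁.trans_le (hR y).1
  have hφ : ∀ y, 0 < N.phi (ρ y) := fun y => N.phi_pos (hρ y) (hlt y)
  have hφ1 : ∀ y, N.phi R₁ ≤ N.phi (ρ y) := fun y => N.phi_le_phi hR₁ (hR y).1 (hlt y)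
  have hφ2 : ∀ y, N.phi (ρ y) ≤ N.phi R₂ := fun y => N.phi_le_phi (hρ y) (hR y).2 hR₂
  have hcot : 0 < N.cot (ρ z) := div_pos (N.dphi_pos (hρ z) (hlt z)) (hφ z)
  have hE := energy_gaugeFn_pos (z := z) hs (hφ z).ne'
  have hEeq := energy_gaugeFn (z := z) hs (hφ z).ne'
  by_contra hcon
  push Not at hcon
  obtain ⟨hE1, hE2⟩ := max_lt_iff.1 hcon
  have hτ0 : tangGrad (gaugeFn N ρ) (z : Amb n) ≠ 0 := by
    intro h0
    rw [hEeq, h0, norm_zero] at hE2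
    simp at hE2
  have hτ := hs.inner_self_tangGrad (sphere_norm z)
  have hH := hs.hess_tangGrad (sphere_norm z) hE.ne' hmax
  have hmem := mem_dataShell (z := z) hs (hφ z) (hφ1 z) (hφ2 z)
  obtain ⟨ψ', hψ'1, hψ'2⟩ := hψ' _ hmem
  obtain ⟨hΨm, hΨM⟩ := hψ _ hmem
  have hrad := radial_deriv_nonpos (z := z)
    (ν := ⟨unitNormal N ρ z, by simpa using norm_unitNormal hs (hφ z)⟩) hR₁ hR₂
    (mem_Ioo_of_tangGrad_ne_zero (h z) (hφ z).ne' hR hτ0) (hmono _ _ _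
      (mem_Ioo_of_tangGrad_ne_zero (h z) (hφ z).ne' hR hτ0)) hψ'1
  obtain ⟨D, hD, hDge⟩ := exists_deriv_rhs_ge hτ hs (h z) hφ hφ1 hφ2 hcot rfl hH hψ'1 hψ'2 hrad
  have hK : gaugeFn N ρ z ^ 2 + N.curv = (N.phi (ρ z) ^ 2)⁻¹ := by
    rw [gaugeFn_sphere, N.cot_sq_add (hφ z).ne']
  obtain ⟨D', S₁, hD', hS₁, hle⟩ := hs.exists_deriv_elemPoly_le (γ := fun t => sphereCurve z hτ t)
    (sphere_norm z) hE hα (by rw [gaugeFn_sphere]; exact hcot)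
    (by rw [hK]; have := hφ z; positivity) hmax hτ0 (by rw [sphereCurve_zero])
    (hasDerivAt_sphereCurve hτ) m hpos
  simp only [heq] at hD'
  obtain rfl : D' = D := hD'.unique hD
  -- the lower bound for `S₁` from Maclaurin's inequality
  have hw := shapeScale_pos (z := z) hs (hφ z)
  have hSlow : shapeScale N ρ z ^ m * m₀ ≤ S₁ := by
    refine le_trans ?_ hS₁
    have h1 := genPoly_maclaurin _ μ (fun j hj => by rw [← hμ]; exact hpos j hj) m le_rfl
    rw [← hμ, ← hμ, heq] at h1
    refine (pow_le_pow_iff_left₀ (by positivity) (hpos m (by omega)).le (Nat.succ_ne_zero m)).1 ?_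
    refine le_trans ?_ h1
    rw [mul_pow, mul_pow, ← pow_mul, ← pow_mul, mul_comm m (m + 1)]
    gcongr
    calc m₀ ^ (m + 1) = m₀ ^ m * m₀ := pow_succ _ _
      _ ≤ m₀ ^ m * 1 := by gcongr
      _ ≤ _ := by rw [mul_one]; gcongr
  rw [heq, hK, gaugeFn_sphere, finrank_euclideanSpace_fin] at hle
  push_cast at hle
  exact false_of_maximum_inequalities hα (hφ z) hcot (norm_nonneg _) hE1 hEeq rfl
    ((norm_nonneg _).trans hψ'2) hm₀ (hm₀.trans_le hΨm) hΨM hSlow hDge hle hbig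

end MaximumPrinciple

/-! ### The estimate -/

section Existence

variable {n : ℕ} {N : SpaceForm}

theorem exists_quadratic_gt (c₀ c₁ : ℝ) {p : ℝ} (q : ℝ) (hp : 0 < p) :
    ∃ α : ℝ, 0 < α ∧ c₀ + c₁ * α < p * α ^ 2 - q * α := by
  refine ⟨(|c₀| + |c₁| + |q|) / p + 1, by positivity, ?_⟩
  set α := (|c₀| + |c₁| + |q|) / p + 1 with hα
  have h1 : p * α = |c₀| + |c₁| + |q| + p := by rw [hα]; field_simp
  have h2 : 1 ≤ α := by rw [hα]; have : 0 ≤ (|c₀| + |c₁| + |q|) / p := by positivity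
                        linarith
  have h3 : c₀ ≤ |c₀| * α := (le_abs_self c₀).trans (le_mul_of_one_le_right (abs_nonneg _) h2)
  have h4 : c₁ * α ≤ |c₁| * α := by gcongr; exact le_abs_self c₁
  have h5 : q * α ≤ |q| * α := by gcongr; exact le_abs_self q
  have h6 : p * α ^ 2 = (|c₀| + |c₁| + |q| + p) * α := by rw [← h1]; ring
  have h7 : 0 < p * α := by positivity
  linarith

/-- The exponent `α` in the test function can be chosen uniformly in the point of the graph. -/
theorem exists_exponent {m : ℕ} {f₀ f₁ v₁ L M₀ m₀ d : ℝ} (hf₀ : 0 < f₀) (hf₁ : f₀ ≤ f₁)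
    (hv₁ : 0 ≤ v₁) (hL : 0 ≤ L) (hM₀ : 0 ≤ M₀) (hm₀ : 0 < m₀) (hd : 0 ≤ d) :
    ∃ α : ℝ, 0 < α ∧ ∀ f v : ℝ, f₀ ≤ f → f ≤ f₁ → 0 < v → v ≤ v₁ →
      f * (v * ((m + 1) * M₀) + L * (f + f⁻¹ * ((v * f ^ 2 + α + f) + (1 + α / f + f * v)))) <
        m₀ * (α ^ 2 * (f ^ 2)⁻¹ - α * v * d) := by
  have hf₁pos := hf₀.trans_le hf₁
  obtain ⟨α, hα, hlt⟩ := exists_quadratic_gt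
    (f₁ * (v₁ * ((m + 1) * M₀) + L * (f₁ + f₀⁻¹ * (v₁ * f₁ ^ 2 + f₁ + 1 + f₁ * v₁))))
    (f₁ * (L * (f₀⁻¹ * (1 + f₀⁻¹)))) (p := m₀ * (f₁ ^ 2)⁻¹) (m₀ * (v₁ * d)) (by positivity)
  refine ⟨α, hα, fun f v h1 h2 h3 h4 => ?_⟩
  have hf : 0 < f := hf₀.trans_le h1
  calc f * (v * ((m + 1) * M₀) + L * (f + f⁻¹ * ((v * f ^ 2 + α + f) + (1 + α / f + f * v))))
      ≤ f₁ * (v₁ * ((m + 1) * M₀) + L * (f₁ + f₀⁻¹ * ((v₁ * f₁ ^ 2 + α + f₁) +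
          (1 + α / f₀ + f₁ * v₁)))) := by gcongr
    _ = f₁ * (v₁ * ((m + 1) * M₀) + L * (f₁ + f₀⁻¹ * (v₁ * f₁ ^ 2 + f₁ + 1 + f₁ * v₁))) +
        f₁ * (L * (f₀⁻¹ * (1 + f₀⁻¹))) * α := by ring
    _ < m₀ * (f₁ ^ 2)⁻¹ * α ^ 2 - m₀ * (v₁ * d) * α := hlt
    _ = m₀ * (α ^ 2 * (f₁ ^ 2)⁻¹ - α * v₁ * d) := by ring
    _ ≤ _ := by gcongr

theorem testFn_dir {K α : ℝ} {s : Amb n → ℝ} (hs : IsGauge s) {x : Amb n} (hx : x ≠ 0) :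
    IsGauge.testFn K α s (dir x) = IsGauge.testFn K α s x := by
  have h1 : gradient s (dir x) = gradient s x := hs.gradient_smul (by positivity) hx
  have h2 : s (dir x) = ‖x‖⁻¹ * s x := hs.smul _ (by positivity) x
  rw [IsGauge.testFn, IsGauge.testFn, energy, energy, h1, h2, norm_dir hx]
  ring

/-- The test function attains its maximum over the sphere, and by homogeneity this is a maximum
over all of `ℝ^{n+1} ∖ {0}`. -/
theorem exists_isLocalMax_testFn {K : ℝ} (α : ℝ) {s : Amb n → ℝ} (hs : IsGauge s)
    (hE : ∀ z : Sph n, energy K s (z : Amb n) ≠ 0) (z₁ : Sph n) :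
    ∃ z₀ : Sph n, IsLocalMax (IsGauge.testFn K α s) (z₀ : Amb n) ∧
      ∀ z : Sph n, IsGauge.testFn K α s (z : Amb n) ≤ IsGauge.testFn K α s (z₀ : Amb n) := by
  have hcont : Continuous fun z : Sph n => IsGauge.testFn K α s (z : Amb n) := by
    rw [continuous_iff_continuousAt]
    exact fun z => (hs.hasFDerivAt_testFn (sphere_ne_zero z) (hE z)).continuousAt.comp
      continuous_subtype_val.continuousAt
  obtain ⟨z₀, hz₀⟩ := hcont.exists_forall_ge' (x₀ := z₁) (by simp)
  refine ⟨z₀, ?_, hz₀⟩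
  filter_upwards [isOpen_ne.mem_nhds (sphere_ne_zero z₀)] with x hx
  rw [← testFn_dir hs hx]
  exact hz₀ ⟨dir x, by simpa using norm_dir hx⟩

theorem norm_sphGrad_eq {ρ : Sph n → ℝ} {z : Sph n}
    (h : DifferentiableAt ℝ (homExt ρ) (z : Amb n)) (hφ : N.phi (ρ z) ≠ 0) :
    ‖sphGrad ρ z‖ = N.phi (ρ z) ^ 2 * ‖tangGrad (gaugeFn N ρ) (z : Amb n)‖ := by
  rw [tangGrad_gaugeFn h hφ, norm_smul, norm_neg, norm_inv, norm_pow, Real.norm_eq_abs, sq_abs]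
  field_simp

end Existence

theorem lemma2 (N : SpaceForm) (n k : ℕ) (hk : 1 ≤ k) (hkn : k ≤ n)
    (R₁ R₂ : ℝ) (hR₁ : 0 < R₁) (hR₂ : (R₂ : EReal) < N.outerRadius)
    (ψ : Amb n × Amb n → ℝ)
    (hψ : ContDiffOn ℝ 2 ψ (dataShell N n R₁ R₂))
    (hψpos : ∀ p ∈ dataShell N n R₁ R₂, 0 < ψ p)
    (hmono : ∀ z ν : Sph n, ∀ r ∈ Set.Ioo R₁ R₂,
      deriv (fun t : ℝ => N.phi t ^ k * ψ (N.phi t • (z : Amb n), (ν : Amb n))) r ≤ 0) :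
    ∃ C c : ℝ, 0 < c ∧
      ∀ (ρ : Sph n → ℝ) (ν : Sph n → Amb n) (κ : Sph n → Fin n → ℝ),
        ContMDiff (𝓡 n) 𝓘(ℝ, ℝ) 3 ρ →
        (∀ z, R₁ ≤ ρ z ∧ ρ z ≤ R₂) →
        (∀ z, IsOuterUnitNormal N ρ z (ν z)) →
        (∀ z, ArePrincipalCurvatures N ρ z (ν z) (κ z)) →
        (∀ z, sigmaK k (κ z) =
          ψ (N.phi (ρ z) • (z : Amb n), polarFrame N (radialGraph ρ z) (ν z))) →
        ∀ z, ‖sphGrad ρ z‖ ≤ C ∧ c ≤ supportFn N ρ z (ν z) := by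
  obtain ⟨m, rfl⟩ : ∃ m, k = m + 1 := ⟨k - 1, by omega⟩
  rcases lt_or_ge R₂ R₁ with hR | hR
  · exact ⟨0, 1, one_pos, fun ρ ν κ _ hρ _ _ _ z => absurd ((hρ z).1.trans (hρ z).2) (not_le.2 hR)⟩
  have hR₁a : (R₁ : EReal) < N.outerRadius := lt_of_le_of_lt (EReal.coe_le_coe_iff.2 hR) hR₂
  set S := dataShell N n R₁ R₂ with hS
  have hScomp : IsCompact S := isCompact_dataShell N n R₁ R₂
  -- bounds for `ψ` and its derivatives
  obtain ⟨L, hL0, hL⟩ := (hψ.of_le (by norm_num)).exists_bound_fderivWithin hScomp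
  obtain ⟨M, hM⟩ := hScomp.bddAbove_image hψ.continuousOn
  obtain ⟨B, hB⟩ := hScomp.bddAbove_image (hψ.continuousOn.inv₀ fun p hp => (hψpos p hp).ne')
  set m₀ : ℝ := (max B 1)⁻¹ with hm₀def
  have hm₀ : 0 < m₀ := by positivity
  have hm₁ : m₀ ≤ 1 := inv_le_one_of_one_le₀ (le_max_right _ _)
  have hψb : ∀ p ∈ S, m₀ ≤ ψ p ∧ ψ p ≤ max M 0 := fun p hp =>
    ⟨inv_le_of_inv_le₀ (hψpos p hp) ((hB ⟨p, hp, rfl⟩).trans (le_max_left _ _)),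
      (hM ⟨p, hp, rfl⟩).trans (le_max_left _ _)⟩
  -- bounds for `φ` and `φ' / φ`
  set f₀ := N.phi R₁ with hf₀def
  set f₁ := N.phi R₂ with hf₁def
  have hf₀ : 0 < f₀ := N.phi_pos hR₁ hR₁a
  have hf₁ : f₀ ≤ f₁ := N.phi_le_phi hR₁ hR hR₂
  set v₁ := f₀⁻¹ + 1 with hv₁def
  have hv₁ : 0 ≤ v₁ := by positivity
  obtain ⟨α, hα, hbig⟩ := exists_exponent (m := m) hf₀ hf₁ hv₁ hL0 (le_max_right M 0) hm₀
    (show (0 : ℝ) ≤ n + 1 by positivity)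
  set E₁ : ℝ := max 1 (f₀ ^ 2)⁻¹ * Real.exp (2 * α * v₁) with hE₁def
  have hE₁ : 0 < E₁ := by positivity
  refine ⟨f₁ ^ 2 * √E₁, (√E₁)⁻¹, inv_pos.2 (Real.sqrt_pos.2 hE₁), ?_⟩
  intro ρ ν κ hρ3 hρR hν hκ hσ z
  have hlt : ∀ y, (ρ y : EReal) < N.outerRadius := fun y =>
    lt_of_le_of_lt (EReal.coe_le_coe_iff.2 (hρR y).2) hR₂
  have hρ : ∀ y, 0 < ρ y := fun y => hR₁.trans_le (hρR y).1
  have hφ : ∀ y, 0 < N.phi (ρ y) := fun y => N.phi_pos (hρ y) (hlt y)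
  have hφ1 : ∀ y, f₀ ≤ N.phi (ρ y) := fun y => N.phi_le_phi hR₁ (hρR y).1 (hlt y)
  have hφ2 : ∀ y, N.phi (ρ y) ≤ f₁ := fun y => N.phi_le_phi (hρ y) (hρR y).2 hR₂
  have hcot : ∀ y, 0 < N.cot (ρ y) := fun y => div_pos (N.dphi_pos (hρ y) (hlt y)) (hφ y)
  have hcot1 : ∀ y, N.cot (ρ y) ≤ v₁ := fun y => by
    refine (pow_le_pow_iff_left₀ (hcot y).le hv₁ two_ne_zero).1 ?_
    have h1 := N.cot_sq_add (hφ y).ne'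
    have h2 := N.neg_one_le_curv
    have h3 : (N.phi (ρ y) ^ 2)⁻¹ ≤ (f₀ ^ 2)⁻¹ := by
      have := hφ1 y
      gcongr
    have h4 : 0 < f₀⁻¹ := inv_pos.2 hf₀
    rw [← inv_pow f₀] at h3
    rw [hv₁def]
    nlinarith
  have hs : IsGauge (gaugeFn N ρ) := isGauge_gaugeFn hρ3 fun y => (hφ y).ne'
  have h : ∀ y : Sph n, ContDiffAt ℝ 3 (homExt ρ) (y : Amb n) :=
    fun y => contDiffAt_homExt hρ3 (sphere_ne_zero y)
  have hσ' : ∀ y, sigmaK (m + 1) (κ y) =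
      ψ (N.phi (ρ y) • (y : Amb n), unitNormal N ρ y) := fun y => by
    rw [hσ, polarFrame_outerNormal hs (hρ y) (hφ y) (h y) (hν y)]; rfl
  have hmem : ∀ y, (N.phi (ρ y) • (y : Amb n), unitNormal N ρ y) ∈ S := fun y =>
    mem_dataShell hs (hφ y) (hφ1 y) (hφ2 y)
  have hcoeff : ∀ (y : Sph n) (j : ℕ), (elemPoly (shapeOp N.curv (gaugeFn N ρ) (y : Amb n))).coeff j
      = (genPoly Finset.univ fun i => shapeScale N ρ y * κ y i).coeff j := fun y j => by
    rw [elemPoly_shapeOp_coeff hs (hρ y) (hφ y) (h y) (hν y) (hκ y), genPoly_smul_coeff]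
  have hpos := elemPoly_shapeOp_pos hk hkn hs hρ hφ hcot h hν hκ
    fun y => by rw [hσ']; exact hψpos _ (hmem y)
  have heq : ∀ y : Sph n, (elemPoly (shapeOp N.curv (gaugeFn N ρ) (y : Amb n))).coeff (m + 1) =
      shapeScale N ρ y ^ (m + 1) * ψ (N.phi (ρ y) • (y : Amb n), unitNormal N ρ y) := fun y => by
    rw [← hσ', hcoeff, genPoly_smul_coeff, sigmaK_eq_coeff]
  have hE : ∀ y : Sph n, 0 < energy N.curv (gaugeFn N ρ) (y : Amb n) :=
    fun y => energy_gaugeFn_pos hs (hφ y).ne'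
  obtain ⟨z₀, hloc, hmax⟩ := exists_isLocalMax_testFn α hs (fun y => (hE y).ne') z
  have hE₀ := energy_le_of_isLocalMax hα hR₁ hR₂ hρR hs h hL hm₀ hm₁ hψb hmono (hcoeff z₀)
    (hpos z₀) heq hloc (hbig _ _ (hφ1 z₀) (hφ2 z₀) (hcot z₀) (hcot1 z₀))
  have hE₀' : energy N.curv (gaugeFn N ρ) (z₀ : Amb n) ≤ max 1 (f₀ ^ 2)⁻¹ := by
    refine hE₀.trans (max_le_max le_rfl ?_)
    have := hφ1 z₀
    gcongr
  -- comparison of the test function at `z` and at its maximum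
  have hEz : energy N.curv (gaugeFn N ρ) (z : Amb n) ≤ E₁ := by
    have h1 := hmax z
    simp only [IsGauge.testFn, sphere_norm, div_one, gaugeFn_sphere] at h1
    have h2 := Real.log_le_log (hE z₀) hE₀'
    have h3 : 0 < α * N.cot (ρ z) := mul_pos hα (hcot z)
    have h4 : α * N.cot (ρ z₀) ≤ α * v₁ := by have := hcot1 z₀; gcongr
    rw [← Real.log_le_log_iff (hE z) hE₁, hE₁def,
      Real.log_mul (by positivity) (Real.exp_pos _).ne', Real.log_exp]
    linarith
  have hsqrt : √(energy N.curv (gaugeFn N ρ) (z : Amb n)) ≤ √E₁ := Real.sqrt_le_sqrt hEz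
  constructor
  · rw [norm_sphGrad_eq (N := N) ((h z).differentiableAt (by simp)) (hφ z).ne']
    have h1 : ‖tangGrad (gaugeFn N ρ) (z : Amb n)‖ ≤
        √(energy N.curv (gaugeFn N ρ) (z : Amb n)) := by
      refine Real.le_sqrt_of_sq_le ?_
      rw [energy_gaugeFn hs (hφ z).ne']
      have : 0 < (N.phi (ρ z) ^ 2)⁻¹ := inv_pos.2 (pow_pos (hφ z) 2)
      linarith
    have h2 := hφ2 z
    have h3 := (hφ z).le
    have h4 := h1.trans hsqrt
    gcongr
  · rw [supportFn_eq hs (hρ z) (hφ z) (h z) (hν z)]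
    exact inv_anti₀ (Real.sqrt_pos.2 (hE z)) hsqrt
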